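/- Let $\Sigma$ be a compact Riemann surface, possibly with boundary $\partial\Sigma$, and let $D\subset\Sigma$ be a finite set with $D\cap\partial\Sigma=\emptyset$. Let $\mathcal A^2(\Sigma,\star D)$, resp. $\mathcal A^{0,1}(\Sigma,\star D)$, be the space of complex 2-forms, resp. $(0,1)$-forms, that are smooth on $\Sigma\setminus D$ (up to the boundary) and that near each $p\in D$ are of the form $\eta/z^n$, where $z$ is a local holomorphic coordinate with $z(p)=0$, $n\ge 0$ is an integer and $\eta$ is a smooth form of the same type near $p$. Let $\mathcal A^2(\Sigma,\log D)\subset\mathcal A^2(\Sigma,\star D)$ be the subspace of forms that near each $p\in D$ are of the form $\frac{dz}{z}\wedge b$ with $b$ a smooth $(0,1)$-form near $p$. Let $\omega\in\mathcal A^2(\Sigma,\star D)$. Then: 1. there exist $\alpha\in\mathcal A^2(\Sigma,\log D)$ and $\beta\in\mathcal A^{0,1}(\Sigma,\star D)$ such that $\omega=\alpha+\partial\beta$ on $\Sigma\setminus D$, where $\partial$ is the holomorphic de Rham differential; 2. for all such $\alpha,\beta$ the integral $\int_\Sigma\alpha$ is absolutely convergent, the integral $\int_{\partial\Sigma}\beta$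 (with the boundary orientation) is well defined, and the sum $$\int_\Sigma\alpha+\int_{\partial\Sigma}\beta\in\mathbb C$$ does not depend on the choice of $\alpha$ and $\beta$; its common value is the regularized integral of $\omega$. -/

import Mathlib

open scoped Manifold ContDiff Topology ComplexConjugate

noncomputable section

namespace RegInt

/-- The closed upper half plane `{z : ℂ | 0 ≤ Im z}`, the model space of a Riemann surface with
boundary. -/
abbrev HalfPlane : Type := {z : ℂ // 0 ≤ z.im}

/-- The inclusion of the closed upper half plane into `ℂ`, as a partial equivalence. -/
def halfPlaneEquiv : PartialEquiv HalfPlane ℂ where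
  toFun := Subtype.val
  invFun z := ⟨⟨z.re, max z.im 0⟩, le_max_right _ _⟩
  source := Set.univ
  target := {z | 0 ≤ z.im}
  map_source' x _ := x.property
  map_target' _ _ := Set.mem_univ _
  left_inv' := fun ⟨_, hz⟩ _ => Subtype.ext (Complex.ext rfl (max_eq_left hz))
  right_inv' _ hz := Complex.ext rfl (max_eq_left hz)

theorem range_halfPlaneEquiv : Set.range halfPlaneEquiv = {z : ℂ | 0 ≤ z.im} :=
  Subtype.range_val

theorem convex_range_halfPlaneEquiv : Convex ℝ (Set.range halfPlaneEquiv) := by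
  rw [range_halfPlaneEquiv]; exact convex_halfSpace_im_ge 0

theorem nonempty_interior_range_halfPlaneEquiv :
    (interior (Set.range halfPlaneEquiv)).Nonempty := by
  rw [range_halfPlaneEquiv]
  refine ⟨Complex.I, mem_interior.2 ⟨{z | 0 < z.im}, fun z (hz : 0 < z.im) => hz.le, ?_, by simp⟩⟩
  exact isOpen_lt continuous_const Complex.continuous_im

theorem continuous_halfPlaneEquiv_invFun : Continuous halfPlaneEquiv.invFun := by
  refine Continuous.subtype_mk ?_ _
  have h : Continuous fun z : ℂ => Complex.equivRealProdCLM.symm (z.re, max z.im 0) := by fun_prop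
  exact h

/-- The half plane as a model with corners over `ℂ`. A function on a relatively open subset of the
half plane is `C^∞` over `ℂ` iff it is (real) smooth up to the boundary and holomorphic in the
interior. Hence `IsManifold complexModel ∞ X` says that `X` is a Riemann surface, possibly with
boundary (charts with values in the open half plane are charts at interior points). -/
def complexModel : ModelWithCorners ℂ ℂ HalfPlane where
  toPartialEquiv := halfPlaneEquiv
  source_eq := rfl
  convex_range' := by
    have h : IsRCLikeNormedField ℂ := inferInstance
    simp only [h, ↓reduceDIte]
    exact convex_range_halfPlaneEquiv.convex_isRCLikeNormedField
  nonempty_interior' := nonempty_interior_range_halfPlaneEquiv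
  continuous_toFun := continuous_subtype_val
  continuous_invFun := continuous_halfPlaneEquiv_invFun

/-- The same half plane as a model with corners over `ℝ`; it is used for real-smooth functions. -/
def realModel : ModelWithCorners ℝ ℂ HalfPlane where
  toPartialEquiv := halfPlaneEquiv
  source_eq := rfl
  convex_range' := by
    have h : IsRCLikeNormedField ℝ := inferInstance
    simp only [h, ↓reduceDIte]
    exact convex_range_halfPlaneEquiv.convex_isRCLikeNormedField
  nonempty_interior' := nonempty_interior_range_halfPlaneEquiv
  continuous_toFun := continuous_subtype_val
  continuous_invFun := continuous_halfPlaneEquiv_invFun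

section Surface

variable {X : Type*} [TopologicalSpace X]

/-- A chart of the surface regarded as a `ℂ`-valued local coordinate: a bijection between the
domain `(coord e).source = e.source` and a relatively open subset `(coord e).target` of the closed
upper half plane in `ℂ`. -/
abbrev coord (e : OpenPartialHomeomorph X HalfPlane) : PartialEquiv X ℂ :=
  e.extend complexModel

/-- The change of coordinates from the chart `e` to the chart `e'`. -/
def transition (e e' : OpenPartialHomeomorph X HalfPlane) (z : ℂ) : ℂ :=
  coord e' ((coord e).symm z)

/-- The complex derivative of the change of coordinates (one-sided at boundary points). -/
def transitionDeriv (e e' : OpenPartialHomeomorph X HalfPlane) (z : ℂ) : ℂ :=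
  derivWithin (transition e e') {w : ℂ | 0 ≤ w.im} z

/-- The points of the coordinate domain of `e` (seen in `ℂ`) that do not lie over `D`. -/
def puncturedTarget (D : Finset X) (e : OpenPartialHomeomorph X HalfPlane) : Set ℂ :=
  {z | z ∈ (coord e).target ∧ (coord e).symm z ∉ D}

/-- The operator `∂/∂z = (∂/∂x - i ∂/∂y)/2` on functions on the closed upper half plane
(with one-sided derivatives at boundary points). -/
def wirtinger (g : ℂ → ℂ) (z : ℂ) : ℂ :=
  (fderivWithin ℝ g {w : ℂ | 0 ≤ w.im} z 1
    - Complex.I * fderivWithin ℝ g {w : ℂ | 0 ≤ w.im} z Complex.I) / 2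

/-- Near `a`, away from `a` itself, `f = h / (z - a)^n` with `h` a smooth function around `a`. -/
def HasPoleLE (f : ℂ → ℂ) (a : ℂ) (n : ℕ) : Prop :=
  ∃ h : ℂ → ℂ, ContDiffAt ℝ ∞ h a ∧ ∀ᶠ z in 𝓝[≠] a, f z = h z / (z - a) ^ n

variable [ChartedSpace HalfPlane X]

variable (X) in
/-- For `p, q ∈ {0, 1}`: a `(p,q)`-form on `X` that is smooth on `X - D` and has holomorphic poles
of arbitrary order along `D`, that is, an element of `𝒜^{p,q}(X, ⋆D)`.

In a chart `e` with coordinate `z` the form is `f dz^p ∧ dz̄^q` with `f = coeff e`; only the values of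
`coeff e` on `puncturedTarget D e`, for `e` in the atlas, are meaningful. Since `X` has complex
dimension one, all `2`-forms are `(1,1)`-forms: `𝒜^2(X, ⋆D)` is `PoleForm X D 1 1`. -/
structure PoleForm (D : Finset X) (p q : ℕ) where
  /-- The coefficient function in each chart. -/
  coeff : OpenPartialHomeomorph X HalfPlane → ℂ → ℂ
  /-- The local expressions in two charts agree on the overlap: pulling back
  `f' dw^p ∧ dw̄^q` along `w = φ(z)` gives `f'(φ(z)) φ'(z)^p conj(φ'(z))^q dz^p ∧ dz̄^q`. -/
  compatible : ∀ e ∈ atlas HalfPlane X, ∀ e' ∈ atlas HalfPlane X, ∀ z ∈ puncturedTarget D e,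
    (coord e).symm z ∈ e'.source →
      coeff e z = coeff e' (transition e e' z)
        * transitionDeriv e e' z ^ p * conj (transitionDeriv e e' z) ^ q
  /-- The form is smooth (up to the boundary of `X`) away from `D`. -/
  smooth : ∀ e ∈ atlas HalfPlane X, ContDiffOn ℝ ∞ (coeff e) (puncturedTarget D e)
  /-- Around a point of `D` the form is `z⁻ⁿ` times a smooth form, for some natural number `n`. -/
  pole : ∀ e ∈ atlas HalfPlane X, ∀ x ∈ D, x ∈ e.source → ∃ n : ℕ,
    HasPoleLE (coeff e) (coord e x) n

/-- A `2`-form is logarithmic along `D`, i.e. lies in `𝒜^2(X, log D)`: around a point of `D` it is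
`(dz / z) ∧ b` with `b` a smooth `(0,1)`-form. -/
def IsLogarithmic {D : Finset X} (α : PoleForm X D 1 1) : Prop :=
  ∀ e ∈ atlas HalfPlane X, ∀ x ∈ D, x ∈ e.source → HasPoleLE (α.coeff e) (coord e x) 1

/-- The equality `θ = α + ∂β` of forms on `X - D`, where `∂(g dz̄) = (∂g/∂z) dz ∧ dz̄`. -/
def IsSplitting {D : Finset X} (θ α : PoleForm X D 1 1) (β : PoleForm X D 0 1) : Prop :=
  ∀ e ∈ atlas HalfPlane X, ∀ z ∈ puncturedTarget D e,
    θ.coeff e z = α.coeff e z + wirtinger (β.coeff e) z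

variable (X) in
/-- A finite smooth partition of unity on `X` subordinate to charts of the atlas. -/
structure ChartPartition where
  /-- The number of functions. -/
  n : ℕ
  /-- The charts. -/
  chart : Fin n → OpenPartialHomeomorph X HalfPlane
  chart_mem : ∀ i, chart i ∈ atlas HalfPlane X
  /-- The functions, which are nonnegative, smooth, and sum to `1` on `X`. -/
  ρ : SmoothPartitionOfUnity (Fin n) realModel X Set.univ
  subordinate : ∀ i, tsupport (ρ i) ⊆ (chart i).source

/-- A Riemann surface with boundary is a smooth real surface with boundary. -/
theorem isManifold_real [IsManifold complexModel ∞ X] : IsManifold realModel ∞ X := by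
  apply isManifold_of_contDiffOn
  intro e e' he he'
  have h := (contDiffGroupoid ∞ complexModel).compatible he he'
  rw [contDiffGroupoid, mem_groupoid_of_pregroupoid] at h
  exact h.1.restrict_scalars ℝ

/-- Every compact Riemann surface has a finite partition of unity subordinate to charts. -/
theorem nonempty_chartPartition [T2Space X] [CompactSpace X] [IsManifold complexModel ∞ X] :
    Nonempty (ChartPartition X) := by
  have := isManifold_real (X := X)
  obtain ⟨t, ht⟩ := isCompact_univ.elim_nhds_subcover
    (fun x : X => (chartAt HalfPlane x).source)
    (fun x _ => (chartAt HalfPlane x).open_source.mem_nhds (mem_chart_source _ x))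
  let f : Fin t.card ≃ t := t.equivFin.symm
  obtain ⟨ρ, hρ⟩ := SmoothPartitionOfUnity.exists_isSubordinate (I := realModel) (M := X)
    (isClosed_univ (X := X)) (fun i : Fin t.card => (chartAt HalfPlane (f i : X)).source)
    (fun i => (chartAt HalfPlane (f i : X)).open_source) (by
      intro x hx
      obtain ⟨y, hy, hxy⟩ := Set.mem_iUnion₂.1 (ht.2 hx)
      exact Set.mem_iUnion.2 ⟨f.symm ⟨y, hy⟩, by simpa using hxy⟩)
  exact ⟨⟨t.card, fun i => chartAt HalfPlane (f i : X), fun i => chart_mem_atlas _ _, ρ, hρ⟩⟩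

/-- The integrand of `∫ ρ_i α` in the coordinate `z = x + i y` of the `i`-th chart, with respect to
Lebesgue measure `dx dy`; note that `dz ∧ dz̄ = -2i dx ∧ dy`. -/
def surfaceIntegrand {D : Finset X} (P : ChartPartition X) (α : PoleForm X D 1 1) (i : Fin P.n)
    (z : ℂ) : ℂ :=
  (P.ρ i ((coord (P.chart i)).symm z) : ℂ) * α.coeff (P.chart i) z * (-2 * Complex.I)

/-- The integral `∫_X α` is absolutely convergent and equals `a`. As usual it is
`∑ i, ∫ ρ_i α` for a partition of unity; convergence and the value are required for all of them. -/
def HasSurfaceIntegral {D : Finset X} (α : PoleForm X D 1 1) (a : ℂ) : Prop :=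
  ∀ P : ChartPartition X,
    (∀ i, MeasureTheory.IntegrableOn (surfaceIntegrand P α i) (coord (P.chart i)).target
      MeasureTheory.volume) ∧
    ∑ i, ∫ z in (coord (P.chart i)).target, surfaceIntegrand P α i z = a

/-- The part of the real axis that lies in the coordinate domain of `e`: it parametrizes the
boundary points of `X` in the chart `e`. Traversed from left to right it has the half plane on its
left, so this is the boundary orientation. -/
def boundaryTarget (e : OpenPartialHomeomorph X HalfPlane) : Set ℝ :=
  {x | (x : ℂ) ∈ (coord e).target}

/-- The integrand of `∫ ρ_i β` along the real axis in the `i`-th chart; there `dz̄ = dx`. -/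
def boundaryIntegrand {D : Finset X} (P : ChartPartition X) (β : PoleForm X D 0 1) (i : Fin P.n)
    (x : ℝ) : ℂ :=
  (P.ρ i ((coord (P.chart i)).symm (x : ℂ)) : ℂ) * β.coeff (P.chart i) (x : ℂ)

/-- The integral `∫_{∂X} β`, with the boundary orientation, is absolutely convergent and equals
`b`. -/
def HasBoundaryIntegral {D : Finset X} (β : PoleForm X D 0 1) (b : ℂ) : Prop :=
  ∀ P : ChartPartition X,
    (∀ i, MeasureTheory.IntegrableOn (boundaryIntegrand P β i) (boundaryTarget (P.chart i))
      MeasureTheory.volume) ∧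
    ∑ i, ∫ x in boundaryTarget (P.chart i), boundaryIntegrand P β i x = b

end Surface

end RegInt

end

open scoped Manifold ContDiff Topology ComplexConjugate

noncomputable section

/-! Existence is local at `D`. Put u = z - a and let f = h / u^(n+2) with h smooth. For g = -h /
((n+1) u^(n+1)) one finds f - ∂g/∂z = (∂h/∂z) / ((n+1) u^(n+1)), so one integration by parts lowers
the order of the pole (`exists_lower_pole`); iterating leaves order at most one (`exists_log_pole`).
Multiplied by a bump function and extended by zero, the local primitives become global (0,1)-forms
that do not interfere at the other points of `D`. Their sum is β, and α = θ - ∂β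
(`exists_splitting`).

For independence, take two splittings (α, β), (α', β') and put γ = β' - β, so that ∂γ = α - α' is
logarithmic. This forces γ to have no pole: if g = h / u^(n+1) and ∂g/∂z = k / u, then (n+1) h = u
(∂h/∂z - k u^n), so h is divisible by u and the order of g drops (`HasPoleLE.of_wirtinger_log`).
Hence γ extends smoothly across `D`, no small circles contribute, and Stokes' theorem
(`surfaceSum_del`) gives ∫(α - α') = ∫_∂ (β' - β), which is the claim. Here ∂γ = dγ because γ is of
type (0,1).

The integrals exist because 1/|z| is locally integrable in the plane, and because `D` avoids the
boundary, where β is therefore continuous. They are independent of the partition of unity because a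
form supported in two charts has the same integral in both: a holomorphic transition φ has real
Jacobian φ' · conj φ', and along the boundary φ' is real and positive (`transitionDeriv_boundary`).

Stokes' theorem is reduced by a partition of unity to a compactly supported function on the half
plane (`integral_wirtinger_halfPlane`), where it is the rectangle formula applied to the complex
conjugate function. -/

namespace RegInt

/-! ### The closed half plane. -/

section HalfPlane

/-- The closed upper half plane as a subset of `ℂ`. -/
abbrev upperHalf : Set ℂ := {w : ℂ | 0 ≤ w.im}

theorem uniqueDiffOn_halfPlane_real : UniqueDiffOn ℝ upperHalf := by
  have := realModel.uniqueDiffOn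
  rwa [show Set.range realModel = upperHalf from range_halfPlaneEquiv] at this

theorem range_complexModel : Set.range complexModel = upperHalf := range_halfPlaneEquiv

theorem uniqueDiffOn_halfPlane : UniqueDiffOn ℂ upperHalf := by
  have := complexModel.uniqueDiffOn
  rwa [range_complexModel] at this

theorem isClosed_halfPlane : IsClosed upperHalf := isClosed_le continuous_const Complex.continuous_im

theorem halfPlane_mem_nhds {z : ℂ} (hz : 0 < z.im) : upperHalf ∈ 𝓝 z :=
  Filter.mem_of_superset ((isOpen_lt continuous_const Complex.continuous_im).mem_nhds hz)
    fun w (hw : 0 < w.im) => hw.le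

theorem interior_halfPlane : interior upperHalf = {w : ℂ | 0 < w.im} := Complex.interior_setOfPred_le_im 0

end HalfPlane

/-! ### Local coordinates and holomorphic transition maps. -/

section Charts

variable {X : Type*} [TopologicalSpace X]

/-- The part of the target of the coordinate `e` that lies over `V`. -/
def region (e : OpenPartialHomeomorph X HalfPlane) (V : Set X) : Set ℂ :=
  {z | z ∈ (coord e).target ∧ (coord e).symm z ∈ V}

theorem coord_source (e : OpenPartialHomeomorph X HalfPlane) : (coord e).source = e.source :=
  e.extend_source

theorem coord_symm_mem {e : OpenPartialHomeomorph X HalfPlane} {z : ℂ}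
    (hz : z ∈ (coord e).target) : (coord e).symm z ∈ e.source :=
  coord_source e ▸ (coord e).map_target hz

theorem coord_mem {e : OpenPartialHomeomorph X HalfPlane} {x : X}
    (hx : x ∈ e.source) : coord e x ∈ (coord e).target :=
  (coord e).map_source ((coord_source e).symm ▸ hx)

theorem coord_left_inv {e : OpenPartialHomeomorph X HalfPlane} {x : X}
    (hx : x ∈ e.source) : (coord e).symm (coord e x) = x :=
  (coord e).left_inv ((coord_source e).symm ▸ hx)

theorem coord_target_subset (e : OpenPartialHomeomorph X HalfPlane) : (coord e).target ⊆ upperHalf := by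
  rw [← range_complexModel]; exact e.extend_target_subset_range

/-- Charts are homeomorphisms onto relatively open sets. The explicit open `U` is what allows
derivatives within a region to be replaced by derivatives within the half plane. -/
theorem exists_region_eq (e : OpenPartialHomeomorph X HalfPlane) {V : Set X} (hV : IsOpen V) :
    ∃ U : Set ℂ, IsOpen U ∧ region e V = U ∩ upperHalf := by
  refine ⟨complexModel.symm ⁻¹' (e.target ∩ e.symm ⁻¹' V),
    (e.isOpen_inter_preimage_symm hV).preimage complexModel.continuous_symm, ?_⟩
  rw [← range_complexModel]
  ext z
  simp only [region, coord, OpenPartialHomeomorph.extend_target, Set.mem_ofPred_eq, Set.mem_inter_iff,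
    Set.mem_preimage, OpenPartialHomeomorph.extend_coe_symm, Function.comp]
  tauto

theorem region_subset_target (e : OpenPartialHomeomorph X HalfPlane) (V : Set X) :
    region e V ⊆ (coord e).target := fun _ h => h.1

theorem region_univ (e : OpenPartialHomeomorph X HalfPlane) :
    region e Set.univ = (coord e).target := by
  ext z; simp [region]

theorem puncturedTarget_eq_region (D : Finset X) (e : OpenPartialHomeomorph X HalfPlane) :
    puncturedTarget D e = region e (D : Set X)ᶜ := by
  ext z; simp [region, puncturedTarget]

theorem region_mem_nhdsWithin {e : OpenPartialHomeomorph X HalfPlane} {V : Set X} (hV : IsOpen V)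
    {z : ℂ} (hz : z ∈ region e V) : region e V ∈ 𝓝[upperHalf] z := by
  obtain ⟨U, hU, h⟩ := exists_region_eq e hV
  rw [h] at hz ⊢
  exact Filter.inter_mem (mem_nhdsWithin_of_mem_nhds (hU.mem_nhds hz.1)) self_mem_nhdsWithin

theorem region_mem_nhds {e : OpenPartialHomeomorph X HalfPlane} {V : Set X} (hV : IsOpen V)
    {z : ℂ} (hz : z ∈ region e V) (h0 : 0 < z.im) : region e V ∈ 𝓝 z := by
  rw [← nhdsWithin_eq_nhds.2 (halfPlane_mem_nhds h0)]
  exact region_mem_nhdsWithin hV hz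

theorem measurableSet_region (e : OpenPartialHomeomorph X HalfPlane) {V : Set X} (hV : IsOpen V) :
    MeasurableSet (region e V) := by
  obtain ⟨U, hU, h⟩ := exists_region_eq e hV
  rw [h]
  exact hU.measurableSet.inter isClosed_halfPlane.measurableSet

theorem measurableSet_target (e : OpenPartialHomeomorph X HalfPlane) :
    MeasurableSet (coord e).target :=
  region_univ e ▸ measurableSet_region e isOpen_univ

theorem uniqueDiffOn_region (e : OpenPartialHomeomorph X HalfPlane) {V : Set X} (hV : IsOpen V) :
    UniqueDiffOn ℂ (region e V) := by
  obtain ⟨U, hU, h⟩ := exists_region_eq e hV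
  rw [h, Set.inter_comm]
  exact uniqueDiffOn_halfPlane.inter hU

theorem isOpen_compl_finset [T2Space X] (D : Finset X) : IsOpen (D : Set X)ᶜ :=
  D.finite_toSet.isClosed.isOpen_compl

theorem continuousOn_coord_symm (e : OpenPartialHomeomorph X HalfPlane) :
    ContinuousOn (coord e).symm (coord e).target :=
  OpenPartialHomeomorph.continuousOn_extend_symm e

variable {e e' e'' : OpenPartialHomeomorph X HalfPlane} {z : ℂ}

theorem coord_symm_transition (hz : z ∈ region e e'.source) :
    (coord e').symm (transition e e' z) = (coord e).symm z :=
  coord_left_inv hz.2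

theorem transition_mem_target (hz : z ∈ region e e'.source) :
    transition e e' z ∈ (coord e').target :=
  coord_mem hz.2

theorem transition_mem (hz : z ∈ region e e'.source) :
    transition e e' z ∈ region e' e.source :=
  ⟨transition_mem_target hz, by rw [coord_symm_transition hz]; exact coord_symm_mem hz.1⟩

theorem transition_transition (hz : z ∈ region e e'.source) :
    transition e' e'' (transition e e' z) = transition e e'' z := by
  rw [transition, coord_symm_transition hz, transition]

theorem transition_self (hz : z ∈ (coord e).target) : transition e e z = z :=
  (coord e).right_inv hz

theorem transition_symm (hz : z ∈ region e e'.source) :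
    transition e' e (transition e e' z) = z := by
  rw [transition_transition hz, transition_self hz.1]

theorem injOn_transition : Set.InjOn (transition e e') (region e e'.source) := by
  intro z hz w hw h
  rw [← transition_symm hz, h, transition_symm hw]

theorem image_transition : transition e e' '' region e e'.source = region e' e.source := by
  apply Set.Subset.antisymm
  · rintro _ ⟨z, hz, rfl⟩; exact transition_mem hz
  · exact fun w hw => ⟨_, transition_mem hw, transition_symm hw⟩

theorem transitionDeriv_self (hz : z ∈ (coord e).target) : transitionDeriv e e z = 1 := by
  have h : HasDerivWithinAt (transition e e) 1 upperHalf z := by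
    refine (hasDerivWithinAt_id z _).congr_of_eventuallyEq ?_ (transition_self hz)
    have := region_mem_nhdsWithin isOpen_univ (e := e) (z := z) (by rwa [region_univ])
    rw [region_univ] at this
    filter_upwards [this] with y hy using transition_self hy
  exact h.derivWithin (uniqueDiffOn_halfPlane z (coord_target_subset _ hz))

theorem mem_interior_target_iff {z : ℂ} (hz : z ∈ (coord e).target) :
    z ∈ interior (coord e).target ↔ 0 < z.im := by
  constructor
  · intro h
    have := interior_mono (coord_target_subset e) h
    rwa [interior_halfPlane] at this
  · intro h
    have := region_mem_nhds isOpen_univ (e := e) (z := z) (by rwa [region_univ]) h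
    rw [region_univ] at this
    exact mem_interior_iff_mem_nhds.2 this

variable [ChartedSpace HalfPlane X] [IsManifold complexModel ∞ X]

theorem contDiffOn_transition (he : e ∈ atlas HalfPlane X) (he' : e' ∈ atlas HalfPlane X) :
    ContDiffOn ℂ ∞ (transition e e') (region e e'.source) := by
  have h := complexModel.contDiffOn_extendCoordChange (IsManifold.subset_maximalAtlas he :
    e ∈ IsManifold.maximalAtlas complexModel ∞ X) (IsManifold.subset_maximalAtlas he' :
    e' ∈ IsManifold.maximalAtlas complexModel ∞ X)
  refine h.mono fun z hz => ?_
  simpa [region] using hz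

theorem contDiffOn_transition_real (he : e ∈ atlas HalfPlane X) (he' : e' ∈ atlas HalfPlane X) :
    ContDiffOn ℝ ∞ (transition e e') (region e e'.source) :=
  (contDiffOn_transition he he').restrict_scalars ℝ

theorem hasDerivWithinAt_transition (he : e ∈ atlas HalfPlane X) (he' : e' ∈ atlas HalfPlane X)
    (hz : z ∈ region e e'.source) :
    HasDerivWithinAt (transition e e') (transitionDeriv e e' z) upperHalf z := by
  have h := ((contDiffOn_transition he he').differentiableOn (by simp) z hz).mono_of_mem_nhdsWithin
    (region_mem_nhdsWithin e'.open_source hz)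
  exact h.hasDerivWithinAt

theorem contDiffOn_transitionDeriv (he : e ∈ atlas HalfPlane X) (he' : e' ∈ atlas HalfPlane X) :
    ContDiffOn ℂ ∞ (transitionDeriv e e') (region e e'.source) := by
  have h := (contDiffOn_transition he he').derivWithin (m := ∞)
    (uniqueDiffOn_region e e'.open_source) (by simp)
  refine h.congr fun z hz => ?_
  obtain ⟨U, hU, h⟩ := exists_region_eq e e'.open_source
  rw [h] at hz ⊢
  rw [transitionDeriv, Set.inter_comm, derivWithin_inter (hU.mem_nhds hz.1)]

theorem transitionDeriv_comp (he : e ∈ atlas HalfPlane X) (he' : e' ∈ atlas HalfPlane X)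
    (he'' : e'' ∈ atlas HalfPlane X)
    (hz : z ∈ region e e'.source) (hz' : z ∈ region e e''.source) :
    transitionDeriv e e'' z
      = transitionDeriv e' e'' (transition e e' z) * transitionDeriv e e' z := by
  have hw : transition e e' z ∈ region e' e''.source :=
    ⟨transition_mem_target hz, by rw [coord_symm_transition hz]; exact hz'.2⟩
  have h1 := hasDerivWithinAt_transition he he' hz
  have h2 := hasDerivWithinAt_transition he' he'' hw
  have h1' := h1.mono fun y (hy : y ∈ region e e'.source) => coord_target_subset _ hy.1
  have h3 := h2.comp z h1' fun y hy => coord_target_subset _ (transition_mem_target hy)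
  have h4 := (h3.mono_of_mem_nhdsWithin (region_mem_nhdsWithin e'.open_source hz)).congr_of_eventuallyEq
    (f₁ := transition e e'') (by
      filter_upwards [region_mem_nhdsWithin e'.open_source hz] with y hy
      exact (transition_transition hy).symm) (transition_transition hz).symm
  exact h4.derivWithin (uniqueDiffOn_halfPlane z (coord_target_subset _ hz.1))

theorem transitionDeriv_mul_symm (he : e ∈ atlas HalfPlane X) (he' : e' ∈ atlas HalfPlane X)
    (hz : z ∈ region e e'.source) :
    transitionDeriv e' e (transition e e' z) * transitionDeriv e e' z = 1 := by
  rw [← transitionDeriv_comp he he' he hz ⟨hz.1, coord_symm_mem hz.1⟩, transitionDeriv_self hz.1]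

theorem transitionDeriv_ne_zero (he : e ∈ atlas HalfPlane X) (he' : e' ∈ atlas HalfPlane X)
    (hz : z ∈ region e e'.source) : transitionDeriv e e' z ≠ 0 :=
  right_ne_zero_of_mul_eq_one (transitionDeriv_mul_symm he he' hz)

/-- Whether a point is interior may be tested in any chart of the atlas. Consequently transitions
respect the real axis, and points of `D` have positive imaginary part in every chart. -/
theorem isInteriorPoint_iff_coord (he : e ∈ atlas HalfPlane X) {x : X} (hx : x ∈ e.source) :
    complexModel.IsInteriorPoint x ↔ 0 < (coord e x).im := by
  rw [ModelWithCorners.isInteriorPoint_iff_of_mem_atlas (n := ∞) (by simp) he hx]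
  exact mem_interior_target_iff (coord_mem hx)

theorem transition_im_pos_iff (he : e ∈ atlas HalfPlane X) (he' : e' ∈ atlas HalfPlane X)
    (hz : z ∈ region e e'.source) : 0 < (transition e e' z).im ↔ 0 < z.im := by
  rw [transition, ← isInteriorPoint_iff_coord he' hz.2, isInteriorPoint_iff_coord he
    (coord_symm_mem hz.1), (coord e).right_inv hz.1]

theorem transition_im_eq_zero_iff (he : e ∈ atlas HalfPlane X) (he' : e' ∈ atlas HalfPlane X)
    (hz : z ∈ region e e'.source) : (transition e e' z).im = 0 ↔ z.im = 0 := by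
  have h1 : 0 ≤ (transition e e' z).im := coord_target_subset _ (transition_mem_target hz)
  have h2 : 0 ≤ z.im := coord_target_subset _ hz.1
  have := transition_im_pos_iff he he' hz
  rw [← h1.not_lt_iff_eq', ← h2.not_lt_iff_eq', this]

theorem coord_im_pos {D : Finset X} (hD : Disjoint (D : Set X) (complexModel.boundary X))
    (he : e ∈ atlas HalfPlane X) {x : X} (hxD : x ∈ D) (hx : x ∈ e.source) :
    0 < (coord e x).im := by
  rw [← isInteriorPoint_iff_coord he hx, ModelWithCorners.isInteriorPoint_iff_not_isBoundaryPoint]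
  exact fun h => Set.disjoint_left.1 hD hxD h

/-- Along the boundary, changes of coordinates are real and orientation preserving. -/
theorem transitionDeriv_boundary (he : e ∈ atlas HalfPlane X) (he' : e' ∈ atlas HalfPlane X)
    (hz : z ∈ region e e'.source) (h0 : z.im = 0) :
    (transitionDeriv e e' z).im = 0 ∧ 0 < (transitionDeriv e e' z).re := by
  have hd := hasDerivWithinAt_transition he he' hz
  have hf0 := (transition_im_eq_zero_iff he he' hz).2 h0
  -- One-sided derivative of Im φ along the ray z + t v, which stays in the half plane for t ≥ 0.
  have line : ∀ v : ℂ, 0 ≤ v.im →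
      HasDerivWithinAt (fun t : ℝ => (transition e e' (z + t * v)).im)
        (v * transitionDeriv e e' z).im (Set.Ici 0) 0 := by
    intro v hv
    have h1 : HasDerivWithinAt (fun t : ℝ => z + t * v) v (Set.Ici 0) 0 := by
      simpa using ((Complex.ofRealCLM.hasDerivWithinAt (s := Set.Ici (0:ℝ)) (x := 0)).mul_const
        v).const_add z
    have h2 : HasFDerivWithinAt (transition e e')
      ((ContinuousLinearMap.toSpanSingleton ℂ (transitionDeriv e e' z)).restrictScalars ℝ) upperHalf
        (z + (0 : ℝ) * v) := by
      simpa using hd.hasFDerivWithinAt.restrictScalars ℝ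
    have h3 := h2.comp_hasDerivWithinAt (0 : ℝ) h1 (fun t ht => by
      simp only [Set.mem_ofPred_eq, Complex.add_im, Complex.mul_im, Complex.ofReal_re,
        Complex.ofReal_im, h0]
      have := mul_nonneg (Set.mem_Ici.1 ht) hv
      simpa using this)
    have h4 := Complex.imCLM.hasFDerivAt.comp_hasDerivWithinAt (0 : ℝ) h3
    simpa [Function.comp_def] using h4
  have near : ∀ v : ℂ, 0 ≤ v.im → ∀ᶠ t : ℝ in 𝓝[Set.Ici 0] 0, z + t * v ∈ region e e'.source := by
    intro v hv
    have hc : Filter.Tendsto (fun t : ℝ => z + t * v) (𝓝[Set.Ici 0] 0) (𝓝[upperHalf] z) := by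
      refine tendsto_nhdsWithin_iff.2 ⟨?_, ?_⟩
      · have : Continuous fun t : ℝ => z + t * v := by fun_prop
        simpa using (this.tendsto 0).mono_left nhdsWithin_le_nhds
      · filter_upwards [self_mem_nhdsWithin] with t ht
        have := mul_nonneg (Set.mem_Ici.1 ht) hv
        simpa [h0] using this
    exact hc (region_mem_nhdsWithin e'.open_source hz)
  have him : (transitionDeriv e e' z).im = 0 := by
    -- The direction v = 1 runs along the real axis, where Im φ vanishes; hence Im φ' = 0.
    have h1 := line 1 (by simp)
    have h2 : HasDerivWithinAt (fun t : ℝ => (transition e e' (z + t * 1)).im) 0 (Set.Ici 0) 0 := by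
      refine (hasDerivWithinAt_const (0 : ℝ) _ (0 : ℝ)).congr_of_eventuallyEq ?_ (by simpa using hf0)
      filter_upwards [near 1 (by simp)] with t ht
      exact (transition_im_eq_zero_iff he he' ht).2 (by simp [h0])
    have := (uniqueDiffOn_Ici (0:ℝ)).uniqueDiffWithinAt (Set.self_mem_Ici) |>.eq_deriv _ h1 h2
    simpa using this
  refine ⟨him, lt_of_le_of_ne ?_ fun h => transitionDeriv_ne_zero he he' hz
    (Complex.ext h.symm him)⟩
  -- The direction v = i points inward: Im φ grows from 0 to nonnegative values, so Im (i φ') = Re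
  -- φ' is nonnegative. It is nonzero because φ' is nonzero and real.
  have h1 := line Complex.I (by simp)
  have h2 : 0 ≤ derivWithin (fun t : ℝ => (transition e e' (z + t * Complex.I)).im)
      (Set.Ici 0) 0 := by
    rw [h1.derivWithin ((uniqueDiffOn_Ici (0:ℝ)).uniqueDiffWithinAt Set.self_mem_Ici)]
    rw [hasDerivWithinAt_iff_tendsto_slope] at h1
    have : (𝓝[Set.Ici (0:ℝ) \ {0}] 0).NeBot := by
      rw [show Set.Ici (0:ℝ) \ {0} = Set.Ioi 0 from Set.Ici_sdiff_left]; infer_instance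
    refine ge_of_tendsto h1 ?_
    filter_upwards [self_mem_nhdsWithin, nhdsWithin_mono _ Set.sdiff_subset
      (near Complex.I (by simp))] with t ht ht'
    rw [slope_def_field]
    have h4 : 0 ≤ (transition e e' (z + t * Complex.I)).im :=
      coord_target_subset _ (transition_mem_target ht')
    have h5 : (0:ℝ) ≤ t := ht.1
    simp only [Complex.ofReal_zero, zero_mul, add_zero, hf0, sub_zero]
    positivity
  rw [h1.derivWithin ((uniqueDiffOn_Ici (0:ℝ)).uniqueDiffWithinAt Set.self_mem_Ici)] at h2
  simpa using h2

end Charts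

/-! ### Calculus of ∂/∂z. -/

section Wirtinger

theorem wirtinger_eq {g : ℂ → ℂ} {L : ℂ →L[ℝ] ℂ} {z : ℂ} (h : HasFDerivWithinAt g L upperHalf z)
    (hz : z ∈ upperHalf) : wirtinger g z = (L 1 - Complex.I * L Complex.I) / 2 := by
  rw [wirtinger, h.fderivWithin (uniqueDiffOn_halfPlane_real z hz)]

theorem wirtinger_congr {f g : ℂ → ℂ} {z : ℂ} (h : f =ᶠ[𝓝[upperHalf] z] g)
    (hz : z ∈ upperHalf) : wirtinger f z = wirtinger g z := by
  rw [wirtinger, wirtinger, h.fderivWithin_eq (h.self_of_nhdsWithin hz)]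

theorem wirtinger_congr_nhds {f g : ℂ → ℂ} {z : ℂ} (h : f =ᶠ[𝓝 z] g) :
    wirtinger f z = wirtinger g z := by
  rw [wirtinger, wirtinger, (h.filter_mono nhdsWithin_le_nhds).fderivWithin_eq h.self_of_nhds]

/-- A complex linear differential satisfies L i = i L 1, so the two terms of ∂/∂z agree. -/
theorem wirtinger_of_hasDerivWithinAt {g : ℂ → ℂ} {g' z : ℂ}
    (h : HasDerivWithinAt g g' upperHalf z) (hz : z ∈ upperHalf) : wirtinger g z = g' := by
  rw [wirtinger_eq (h.hasFDerivWithinAt.restrictScalars ℝ) hz]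
  simp only [ContinuousLinearMap.coe_restrictScalars', ContinuousLinearMap.toSpanSingleton_apply,
    smul_eq_mul]
  linear_combination (-g' / 2) * Complex.I_mul_I

/-- A conjugate linear differential satisfies L i = -i L 1, so the two terms of ∂/∂z cancel. -/
theorem wirtinger_conj_of_hasDerivWithinAt {g : ℂ → ℂ} {g' z : ℂ}
    (h : HasDerivWithinAt g g' upperHalf z) (hz : z ∈ upperHalf) :
    wirtinger (fun w => conj (g w)) z = 0 := by
  have := (Complex.conjCLE.toContinuousLinearMap.hasFDerivAt).comp_hasFDerivWithinAt z
    (h.hasFDerivWithinAt.restrictScalars ℝ)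
  rw [wirtinger_eq (g := fun w => conj (g w)) this hz]
  simp
  ring_nf
  simp

/-- The general chain rule has a second term with ∂(conj φ)/∂z; it vanishes because φ is
holomorphic. -/
theorem wirtinger_comp {g φ : ℂ → ℂ} {φ' z : ℂ}
    (hg : DifferentiableWithinAt ℝ g upperHalf (φ z))
    (hφ : HasDerivWithinAt φ φ' upperHalf z) (hz : z ∈ upperHalf)
    (hm : ∀ᶠ w in 𝓝[upperHalf] z, φ w ∈ upperHalf) :
    wirtinger (fun w => g (φ w)) z = wirtinger g (φ z) * φ' := by
  set s := {w | w ∈ upperHalf ∧ φ w ∈ upperHalf}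
  have hs : s ∈ 𝓝[upperHalf] z := Filter.inter_mem self_mem_nhdsWithin hm
  have h := hg.hasFDerivWithinAt.comp z ((hφ.hasFDerivWithinAt.restrictScalars ℝ).mono
    (fun w (hw : w ∈ s) => hw.1)) (fun w hw => hw.2)
  rw [wirtinger_eq (g := fun w => g (φ w)) (h.mono_of_mem_nhdsWithin hs) hz, wirtinger]
  set L := fderivWithin ℝ g upperHalf (φ z)
  -- `L` is only real linear, so it is expanded in the real basis 1, i.
  have key : ∀ v : ℂ, L v = v.re * L 1 + v.im * L Complex.I := by
    intro v
    conv_lhs => rw [← Complex.re_add_im v]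
    have h1 : (v.re : ℂ) = v.re • (1 : ℂ) := by simp
    have h2 : (v.im : ℂ) * Complex.I = v.im • Complex.I := by simp
    rw [map_add, h2, map_smul]
    conv_lhs => rw [h1, map_smul]
    simp
  simp only [ContinuousLinearMap.coe_comp, Function.comp,
    ContinuousLinearMap.coe_restrictScalars', ContinuousLinearMap.toSpanSingleton_apply,
    smul_eq_mul, one_mul]
  rw [key φ', key (Complex.I * φ')]
  have h3 := Complex.re_add_im φ'
  simp only [Complex.mul_re, Complex.mul_im, Complex.I_re, Complex.I_im]
  push_cast
  conv_rhs => rw [← h3]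
  linear_combination ((φ'.im : ℂ) * L Complex.I / 2) * Complex.I_mul_I

variable {f g : ℂ → ℂ} {z : ℂ}

theorem wirtinger_add (hf : DifferentiableWithinAt ℝ f upperHalf z)
    (hg : DifferentiableWithinAt ℝ g upperHalf z) (hz : z ∈ upperHalf) :
    wirtinger (fun w => f w + g w) z = wirtinger f z + wirtinger g z := by
  rw [wirtinger_eq (g := fun w => f w + g w) (hf.hasFDerivWithinAt.add hg.hasFDerivWithinAt) hz, wirtinger, wirtinger]
  simp
  ring

theorem wirtinger_sub (hf : DifferentiableWithinAt ℝ f upperHalf z)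
    (hg : DifferentiableWithinAt ℝ g upperHalf z) (hz : z ∈ upperHalf) :
    wirtinger (fun w => f w - g w) z = wirtinger f z - wirtinger g z := by
  rw [wirtinger_eq (g := fun w => f w - g w) (hf.hasFDerivWithinAt.sub hg.hasFDerivWithinAt) hz, wirtinger, wirtinger]
  simp
  ring

theorem wirtinger_mul (hf : DifferentiableWithinAt ℝ f upperHalf z)
    (hg : DifferentiableWithinAt ℝ g upperHalf z) (hz : z ∈ upperHalf) :
    wirtinger (fun w => f w * g w) z = wirtinger f z * g z + f z * wirtinger g z := by
  rw [wirtinger_eq (g := fun w => f w * g w) (hf.hasFDerivWithinAt.mul hg.hasFDerivWithinAt) hz, wirtinger, wirtinger]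
  simp
  ring

theorem wirtinger_const (c : ℂ) (hz : z ∈ upperHalf) : wirtinger (fun _ => c) z = 0 :=
  wirtinger_of_hasDerivWithinAt (hasDerivWithinAt_const z _ c) hz

theorem wirtinger_sum {ι : Type*} (s : Finset ι) {f : ι → ℂ → ℂ}
    (hf : ∀ i ∈ s, DifferentiableWithinAt ℝ (f i) upperHalf z) (hz : z ∈ upperHalf) :
    wirtinger (fun w => ∑ i ∈ s, f i w) z = ∑ i ∈ s, wirtinger (f i) z := by
  classical
  induction s using Finset.induction_on with
  | empty => simpa using wirtinger_const 0 hz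
  | insert i s hi ih =>
    simp only [Finset.sum_insert hi]
    rw [wirtinger_add (hf i (by simp)) _ hz, ih fun j hj => hf j (by simp [hj])]
    exact DifferentiableWithinAt.fun_sum fun j hj => hf j (by simp [hj])

theorem ContDiffOn.wirtinger {s U : Set ℂ} (hU : IsOpen U) (hs : s = U ∩ upperHalf)
    (hg : ContDiffOn ℝ ∞ g s) : ContDiffOn ℝ ∞ (wirtinger g) s := by
  have hu : UniqueDiffOn ℝ s := by
    rw [hs, Set.inter_comm]; exact uniqueDiffOn_halfPlane_real.inter hU
  have h := hg.fderivWithin (m := ∞) hu (by simp)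
  have h2 : ContDiffOn ℝ ∞ (fun z => (fderivWithin ℝ g s z 1
      - Complex.I * fderivWithin ℝ g s z Complex.I) / 2) s :=
    (((h.clm_apply contDiffOn_const).sub
      (contDiffOn_const.mul (h.clm_apply contDiffOn_const)))).div_const 2
  refine h2.congr fun z hz => ?_
  rw [hs] at hz ⊢
  rw [RegInt.wirtinger, Set.inter_comm, fderivWithin_inter (hU.mem_nhds hz.1)]

theorem ContDiffAt.wirtinger (hz : 0 < z.im) (hg : ContDiffAt ℝ ∞ g z) :
    ContDiffAt ℝ ∞ (wirtinger g) z := by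
  have h := hg.fderiv_right (m := ∞) (by simp)
  have h2 : ContDiffAt ℝ ∞ (fun z => (fderiv ℝ g z 1
      - Complex.I * fderiv ℝ g z Complex.I) / 2) z :=
    (((h.clm_apply contDiffAt_const).sub
      (contDiffAt_const.mul (h.clm_apply contDiffAt_const)))).div_const 2
  refine h2.congr_of_eventuallyEq ?_
  filter_upwards [(isOpen_lt continuous_const Complex.continuous_im).mem_nhds hz] with w hw
  rw [RegInt.wirtinger, fderivWithin_of_mem_nhds (halfPlane_mem_nhds hw)]

end Wirtinger

/-! ### Poles of smooth functions and reduction of their order. -/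

section Poles

theorem eventually_im_pos {a : ℂ} (ha : 0 < a.im) : ∀ᶠ z in 𝓝 a, 0 < z.im :=
  (isOpen_lt continuous_const Complex.continuous_im).mem_nhds ha

/-- `f` is smooth in a punctured neighbourhood of `a`. -/
def SmoothNear (f : ℂ → ℂ) (a : ℂ) : Prop := ∀ᶠ z in 𝓝[≠] a, ContDiffAt ℝ ∞ f z

variable {f g : ℂ → ℂ} {a : ℂ} {n m : ℕ}

theorem HasPoleLE.congr (hf : HasPoleLE f a n) (h : g =ᶠ[𝓝[≠] a] f) : HasPoleLE g a n := by
  obtain ⟨k, hk, hk'⟩ := hf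
  refine ⟨k, hk, ?_⟩
  filter_upwards [hk', h] with z h1 h2
  rw [h2, h1]

theorem HasPoleLE.mono (hf : HasPoleLE f a n) (hnm : n ≤ m) : HasPoleLE f a m := by
  obtain ⟨k, hk, hk'⟩ := hf
  refine ⟨fun z => k z * (z - a) ^ (m - n), hk.mul (by fun_prop), ?_⟩
  filter_upwards [hk', self_mem_nhdsWithin] with z h1 h2
  have : z - a ≠ 0 := sub_ne_zero.2 h2
  rw [h1, ← pow_mul_pow_sub _ hnm]
  field_simp

theorem HasPoleLE.add (hf : HasPoleLE f a n) (hg : HasPoleLE g a n) :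
    HasPoleLE (fun z => f z + g z) a n := by
  obtain ⟨k, hk, hk'⟩ := hf
  obtain ⟨l, hl, hl'⟩ := hg
  refine ⟨fun z => k z + l z, hk.add hl, ?_⟩
  filter_upwards [hk', hl'] with z h1 h2
  rw [h1, h2, add_div]

theorem HasPoleLE.mul_smooth (hf : HasPoleLE f a n) (hg : ContDiffAt ℝ ∞ g a) :
    HasPoleLE (fun z => f z * g z) a n := by
  obtain ⟨k, hk, hk'⟩ := hf
  refine ⟨fun z => k z * g z, hk.mul hg, ?_⟩
  filter_upwards [hk'] with z h1
  rw [h1]; ring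

theorem HasPoleLE.of_contDiffAt (hf : ContDiffAt ℝ ∞ f a) : HasPoleLE f a 0 :=
  ⟨f, hf, by simp⟩

theorem HasPoleLE.sub (hf : HasPoleLE f a n) (hg : HasPoleLE g a n) :
    HasPoleLE (fun z => f z - g z) a n := by
  refine (hf.add (hg.mul_smooth (g := fun _ => -1) contDiffAt_const)).congr ?_
  filter_upwards with z
  ring

theorem wirtinger_div_pow {h : ℂ → ℂ} {z : ℂ} (hz : 0 < z.im) (hza : z ≠ a)
    (hh : DifferentiableAt ℝ h z) (n : ℕ) :
    wirtinger (fun z => h z / (z - a) ^ n) z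
      = (wirtinger h z * (z - a) - n * h z) / (z - a) ^ (n + 1) := by
  have hza' : z - a ≠ 0 := sub_ne_zero.2 hza
  have hd : HasDerivAt (fun z => ((z - a) ^ n)⁻¹)
      (-(n * (z - a) ^ (n - 1)) / ((z - a) ^ n) ^ 2) z := by
    have := (((hasDerivAt_id z).sub_const a).pow n).inv (pow_ne_zero n hza')
    simp only [id_eq, mul_one] at this
    exact this
  have hw := wirtinger_of_hasDerivWithinAt (hd.hasDerivWithinAt (s := upperHalf)) hz.le
  have hm := wirtinger_mul (f := h) (g := fun z => ((z - a) ^ n)⁻¹)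
    hh.differentiableWithinAt
    (hd.hasDerivWithinAt.hasFDerivWithinAt.restrictScalars ℝ).differentiableWithinAt hz.le
  simp only [div_eq_mul_inv] at hm ⊢
  rw [hm, hw]
  -- The exponent n - 1 is truncated at n = 0, where the factor n kills the term anyway.
  rcases n with _ | n
  · simp [hza']
  · simp only [Nat.add_sub_cancel]
    field_simp
    push_cast
    ring

theorem ContDiffAt.eventually_differentiableAt {h : ℂ → ℂ} (hh : ContDiffAt ℝ ∞ h a) :
    ∀ᶠ z in 𝓝 a, DifferentiableAt ℝ h z := by
  have := (hh.of_le (m := 1) (by simp)).eventually (by simp)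
  filter_upwards [this] with z hz using hz.differentiableAt (by simp)

/-- ∂/∂z is local, and a punctured neighbourhood of a is a full neighbourhood of each of its points.
-/
theorem wirtinger_eventuallyEq_of_punctured (h : f =ᶠ[𝓝[≠] a] g) :
    wirtinger f =ᶠ[𝓝[≠] a] wirtinger g := by
  have h2 := eventually_eventually_nhdsWithin.2 h
  filter_upwards [h2, self_mem_nhdsWithin] with z hz hza
  refine wirtinger_congr_nhds ?_
  rw [nhdsWithin_eq_nhds.2 (isOpen_compl_singleton.mem_nhds hza)] at hz
  exact hz

theorem wirtinger_pole (ha : 0 < a.im) {h : ℂ → ℂ} (hh : ContDiffAt ℝ ∞ h a)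
    (hf : ∀ᶠ z in 𝓝[≠] a, f z = h z / (z - a) ^ n) :
    ∀ᶠ z in 𝓝[≠] a, wirtinger f z
      = (wirtinger h z * (z - a) - n * h z) / (z - a) ^ (n + 1) := by
  filter_upwards [wirtinger_eventuallyEq_of_punctured hf, self_mem_nhdsWithin,
    (eventually_im_pos ha).filter_mono nhdsWithin_le_nhds,
    (ContDiffAt.eventually_differentiableAt hh).filter_mono nhdsWithin_le_nhds] with z h1 h2 h3 h4
  rw [h1, wirtinger_div_pow h3 h2 h4]

theorem HasPoleLE.wirtinger (ha : 0 < a.im) (hf : HasPoleLE f a n) :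
    HasPoleLE (wirtinger f) a (n + 1) := by
  obtain ⟨h, hh, hf⟩ := hf
  refine ⟨_, ?_, wirtinger_pole ha hh hf⟩
  exact ((ContDiffAt.wirtinger ha hh).mul (by fun_prop)).sub (contDiffAt_const.mul hh)

theorem SmoothNear.wirtinger (ha : 0 < a.im) (hf : SmoothNear f a) :
    SmoothNear (wirtinger f) a := by
  filter_upwards [hf, (eventually_im_pos ha).filter_mono nhdsWithin_le_nhds] with z h1 h2
  exact ContDiffAt.wirtinger h2 h1

/-- One integration by parts lowers the order of a pole of order at least two. -/
theorem exists_lower_pole (ha : 0 < a.im) (hf : HasPoleLE f a (n + 2)) (hs : SmoothNear f a) :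
    ∃ g, SmoothNear g a ∧ HasPoleLE g a (n + 2) ∧
      HasPoleLE (fun z => f z - wirtinger g z) a (n + 1) := by
  have hn : (n + 1 : ℂ) ≠ 0 := by exact_mod_cast n.succ_ne_zero
  -- If f = h / u^(n+2) with u = z - a, this is g = -h / ((n+1) u^(n+1)), and f - ∂g/∂z = (∂h/∂z) /
  -- ((n+1) u^(n+1)). The order n + 2 recorded for g is not sharp, but any bound will do.
  refine ⟨fun z => f z * (-(z - a) / (n + 1)), ?_, hf.mul_smooth (by fun_prop), ?_⟩
  · filter_upwards [hs] with z hz using hz.mul (by fun_prop)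
  · obtain ⟨h, hh, hfh⟩ := hf
    refine ⟨fun z => wirtinger h z / (n + 1), (ContDiffAt.wirtinger ha hh).div_const _, ?_⟩
    have h1 := wirtinger_pole (n := n + 1) (f := fun z => f z * (-(z - a) / (n + 1))) ha
      (h := fun z => h z * (-1 / (n + 1))) (hh.mul contDiffAt_const) (by
        filter_upwards [hfh, self_mem_nhdsWithin] with z h1 h2
        have hza' : z - a ≠ 0 := sub_ne_zero.2 h2
        rw [h1]
        field_simp
        ring)
    filter_upwards [hfh, h1, self_mem_nhdsWithin,
      (eventually_im_pos ha).filter_mono nhdsWithin_le_nhds,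
      (ContDiffAt.eventually_differentiableAt hh).filter_mono nhdsWithin_le_nhds]
      with z h1 h2 h3 h4 h5
    have hza' : z - a ≠ 0 := sub_ne_zero.2 h3
    rw [h2, h1, wirtinger_mul h5.differentiableWithinAt (differentiableWithinAt_const _) h4.le,
      wirtinger_const _ h4.le]
    push_cast
    field_simp
    ring

/-- Modulo `∂`-exact terms every pole is logarithmic. -/
theorem exists_log_pole (ha : 0 < a.im) (hf : HasPoleLE f a n) (hs : SmoothNear f a) :
    ∃ g, SmoothNear g a ∧ (∃ m, HasPoleLE g a m) ∧
      HasPoleLE (fun z => f z - wirtinger g z) a 1 := by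
  induction n generalizing f with
  | zero =>
    refine ⟨fun _ => 0, by simp [SmoothNear, contDiffAt_const],
      ⟨0, .of_contDiffAt contDiffAt_const⟩, (hf.mono zero_le_one).congr ?_⟩
    filter_upwards [(eventually_im_pos ha).filter_mono nhdsWithin_le_nhds] with z hz
    rw [wirtinger_const _ hz.le, sub_zero]
  | succ n ih =>
    -- A pole of order one is already logarithmic; the denominator n + 1 of the reduction step
    -- requires order at least two.
    rcases n with _ | n
    · refine ⟨fun _ => 0, by simp [SmoothNear, contDiffAt_const],
        ⟨0, .of_contDiffAt contDiffAt_const⟩, hf.congr ?_⟩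
      filter_upwards [(eventually_im_pos ha).filter_mono nhdsWithin_le_nhds] with z hz
      rw [wirtinger_const _ hz.le, sub_zero]
    · obtain ⟨g, hg, hgp, hfg⟩ := exists_lower_pole ha hf hs
      have hs' : SmoothNear (fun z => f z - RegInt.wirtinger g z) a := by
        filter_upwards [hs, hg.wirtinger ha] with z h1 h2 using h1.sub h2
      obtain ⟨k, hk, ⟨m, hkp⟩, hfk⟩ := ih hfg hs'
      refine ⟨fun z => g z + k z, ?_, ⟨max (n + 2) m, (hgp.mono (le_max_left _ _)).add
        (hkp.mono (le_max_right _ _))⟩, hfk.congr ?_⟩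
      · filter_upwards [hg, hk] with z h1 h2 using h1.add h2
      · filter_upwards [hg, hk, (eventually_im_pos ha).filter_mono nhdsWithin_le_nhds]
          with z h1 h2 hz
        rw [wirtinger_add (h1.differentiableAt (by simp)).differentiableWithinAt
          (h2.differentiableAt (by simp)).differentiableWithinAt hz.le]
        ring

/-- If `∂ (g dz̄)` is logarithmic, then `g` has no pole at all. -/
theorem HasPoleLE.of_wirtinger_log (ha : 0 < a.im) (hg : HasPoleLE g a n)
    (hw : HasPoleLE (RegInt.wirtinger g) a 1) : HasPoleLE g a 0 := by
  induction n with
  | zero => exact hg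
  | succ n ih =>
    refine ih ?_
    obtain ⟨h, hh, hgh⟩ := hg
    obtain ⟨k, hk, hwk⟩ := hw
    have hn : (n + 1 : ℂ) ≠ 0 := by exact_mod_cast n.succ_ne_zero
    -- The numerator comes from equating k / u with (u ∂h/∂z - (n+1) h) / u^(n+2) and solving for h
    -- / u.
    refine ⟨fun z => (RegInt.wirtinger h z - k z * (z - a) ^ n) / (n + 1),
      ((ContDiffAt.wirtinger ha hh).sub (hk.mul (by fun_prop))).div_const _, ?_⟩
    filter_upwards [hgh, hwk, wirtinger_pole ha hh hgh, self_mem_nhdsWithin] with z h1 h2 h3 h4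
    have hza' : z - a ≠ 0 := sub_ne_zero.2 h4
    rw [h1]
    rw [h2] at h3
    generalize z - a = u at *
    push_cast at h3
    have h5 : (n + 1) * h z = RegInt.wirtinger h z * u - k z * u ^ (n + 1) := by
      refine mul_left_cancel₀ hza' ?_
      field_simp at h3
      linear_combination h3
    rw [div_div, div_eq_div_iff (by positivity) (by positivity)]
    linear_combination u ^ n * h5

/-- The quotient (φ z - φ a) / (z - a) extends to the analytic function `dslope φ a`, which is
nonzero at a since φ' is. Its inverse power is a smooth factor, so the order is unchanged. -/
theorem HasPoleLE.comp {φ : ℂ → ℂ} (hf : HasPoleLE f (φ a) n)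
    (hφ : AnalyticAt ℂ φ a) (hφ' : deriv φ a ≠ 0) : HasPoleLE (fun z => f (φ z)) a n := by
  obtain ⟨h, hh, hfh⟩ := hf
  have hu : AnalyticAt ℂ (dslope φ a) a := by
    obtain ⟨p, hp⟩ := hφ
    exact hp.has_fpower_series_dslope_fslope.analyticAt
  have hu0 : dslope φ a a ≠ 0 := by rwa [dslope_same]
  have hsm : ∀ {ψ : ℂ → ℂ}, AnalyticAt ℂ ψ a → ContDiffAt ℝ ∞ ψ a := fun hψ =>
    hψ.contDiffAt.restrict_scalars ℝ
  refine ⟨fun z => h (φ z) * (dslope φ a z ^ n)⁻¹, ?_, ?_⟩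
  · exact (hh.comp a (hsm hφ)).mul (hsm ((hu.pow n).inv (pow_ne_zero n hu0)))
  · have h1 : Filter.Tendsto φ (𝓝[≠] a) (𝓝[≠] (φ a)) := by
      refine tendsto_nhdsWithin_iff.2 ⟨hφ.continuousAt.tendsto.mono_left nhdsWithin_le_nhds, ?_⟩
      exact hφ.differentiableAt.hasDerivAt.eventually_ne hφ'
    filter_upwards [h1.eventually hfh, self_mem_nhdsWithin] with z h2 h3
    have hza' : z - a ≠ 0 := sub_ne_zero.2 h3
    rw [h2, dslope_of_ne _ h3, slope_def_field, div_pow]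
    simp only [inv_div]
    -- In the degenerate case both sides are 0, by the convention that division by 0 gives 0.
    by_cases h4 : (φ z - φ a) ^ n = 0
    · simp [h4]
    · field_simp

end Poles

theorem HasPoleLE.sum {ι : Type*} (s : Finset ι) {f : ι → ℂ → ℂ} {a : ℂ}
    (h : ∀ i, ∃ n, HasPoleLE (f i) a n) : ∃ n, HasPoleLE (fun z => ∑ i ∈ s, f i z) a n := by
  classical
  induction s using Finset.induction_on with
  | empty => exact ⟨0, by simpa using HasPoleLE.of_contDiffAt contDiffAt_const⟩
  | insert i s hi ih =>
    obtain ⟨n, hn⟩ := h i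
    obtain ⟨m, hm⟩ := ih
    simp only [Finset.sum_insert hi]
    exact ⟨max n m, (hn.mono (le_max_left _ _)).add (hm.mono (le_max_right _ _))⟩

/-- Multiply by a bump function supported in a closed ball inside U on which g is smooth off the
centre. The product is then smooth on all of ℂ except a, even where g is not. -/
theorem exists_cutoff {g : ℂ → ℂ} {a : ℂ} (hg : SmoothNear g a) {U : Set ℂ} (hU : U ∈ 𝓝 a) :
    ∃ (G : ℂ → ℂ) (K : Set ℂ), IsCompact K ∧ K ⊆ U ∧ (∀ z ∉ K, G z = 0) ∧
      (∀ z ≠ a, ContDiffAt ℝ ∞ G z) ∧ G =ᶠ[𝓝 a] g := by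
  rw [SmoothNear, eventually_nhdsWithin_iff] at hg
  obtain ⟨r, hr, hrU⟩ := Metric.nhds_basis_closedBall.mem_iff.1 (Filter.inter_mem hU hg)
  let χ : ContDiffBump a := ⟨r / 2, r, by positivity, by linarith⟩
  have hout : ∀ z ∉ Metric.closedBall a r, (χ z : ℂ) * g z = 0 := by
    intro z hz
    have : χ z = 0 := χ.zero_of_le_dist (by
      rw [Metric.mem_closedBall, not_le] at hz; exact hz.le)
    rw [this]; simp
  refine ⟨fun z => (χ z : ℂ) * g z, Metric.closedBall a r, isCompact_closedBall a r,
    fun z hz => (hrU hz).1, hout, fun z hza => ?_, ?_⟩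
  · by_cases hz : z ∈ Metric.closedBall a r
    · exact (Complex.ofRealCLM.contDiff.contDiffAt.comp z χ.contDiffAt).mul ((hrU hz).2 hza)
    · refine (contDiffAt_const (c := (0 : ℂ))).congr_of_eventuallyEq ?_
      filter_upwards [Metric.isClosed_closedBall.isOpen_compl.mem_nhds hz] with w hw using hout w hw
  · filter_upwards [χ.eventuallyEq_one] with z hz
    rw [hz]; simp

/-! ### Forms with poles, their differential, and extension by zero. -/

section Forms

variable {X : Type*} [TopologicalSpace X] {D : Finset X}
  {e e' e₀ : OpenPartialHomeomorph X HalfPlane}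

theorem mem_puncturedTarget_transition {z : ℂ} (hz : z ∈ puncturedTarget D e)
    (hz' : (coord e).symm z ∈ e'.source) : transition e e' z ∈ puncturedTarget D e' := by
  have h : z ∈ region e e'.source := ⟨hz.1, hz'⟩
  exact ⟨transition_mem_target h, by rw [coord_symm_transition h]; exact hz.2⟩

theorem overlap_mem_nhdsWithin {z : ℂ} (hz : z ∈ puncturedTarget D e)
    (hz' : (coord e).symm z ∈ e'.source) : region e e'.source ∈ 𝓝[upperHalf] z :=
  region_mem_nhdsWithin e'.open_source ⟨hz.1, hz'⟩

theorem coord_mem_region {x : X} {V : Set X} (hx : x ∈ e.source) (hxV : x ∈ V) :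
    coord e x ∈ region e V :=
  ⟨coord_mem hx, by rwa [coord_left_inv hx]⟩

theorem transition_coord {x : X} (hx : x ∈ e.source) :
    transition e e' (coord e x) = coord e' x := by
  rw [transition, coord_left_inv hx]

theorem deriv_transition {z : ℂ} (h0 : 0 < z.im) :
    deriv (transition e e') z = transitionDeriv e e' z := by
  rw [transitionDeriv, derivWithin_of_mem_nhds (halfPlane_mem_nhds h0)]

theorem puncturedTarget_subset_upperHalf : puncturedTarget D e ⊆ upperHalf :=
  fun _ hz => coord_target_subset e hz.1

open Classical in
/-- The coefficients of the `(0,1)`-form that is `G dz̄` in the chart `e₀` and zero elsewhere. -/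
def extendCoeff (e₀ : OpenPartialHomeomorph X HalfPlane) (G : ℂ → ℂ)
    (e : OpenPartialHomeomorph X HalfPlane) (z : ℂ) : ℂ :=
  if (coord e).symm z ∈ e₀.source then
    G (transition e e₀ z) * conj (transitionDeriv e e₀ z) else 0

theorem extendCoeff_of_mem {G : ℂ → ℂ} {z : ℂ} (hz : (coord e).symm z ∈ e₀.source) :
    extendCoeff e₀ G e z = G (transition e e₀ z) * conj (transitionDeriv e e₀ z) :=
  if_pos hz

theorem extendCoeff_self {G : ℂ → ℂ} {z : ℂ} (hz : z ∈ (coord e₀).target) :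
    extendCoeff e₀ G e₀ z = G z := by
  rw [extendCoeff_of_mem (coord_symm_mem hz), transition_self hz, transitionDeriv_self hz]
  simp

theorem extendCoeff_eq_zero {G : ℂ → ℂ} {K : Set ℂ} (hGK : ∀ z ∉ K, G z = 0) {z : ℂ}
    (hz : (coord e).symm z ∉ (coord e₀).symm '' K) : extendCoeff e₀ G e z = 0 := by
  by_cases h : (coord e).symm z ∈ e₀.source
  · rw [extendCoeff_of_mem h, hGK, zero_mul]
    exact fun hK => hz ⟨_, hK, coord_left_inv h⟩
  · exact if_neg h

section Separated

variable [T2Space X]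

theorem puncturedTarget_mem_nhdsWithin {z : ℂ} (hz : z ∈ puncturedTarget D e) :
    puncturedTarget D e ∈ 𝓝[upperHalf] z := by
  rw [puncturedTarget_eq_region] at hz ⊢
  exact region_mem_nhdsWithin (isOpen_compl_finset D) hz

theorem isClosed_coord_symm_image {K : Set ℂ} (hK : IsCompact K) (hKe : K ⊆ (coord e₀).target) :
    IsClosed ((coord e₀).symm '' K) :=
  (hK.image_of_continuousOn ((continuousOn_coord_symm e₀).mono hKe)).isClosed

/-- `D` is finite, so its other points can be removed by shrinking the neighbourhood; x itself is
excluded by the puncture. -/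
theorem punctured_eventually {x : X} (hx : x ∈ e.source) (h0 : 0 < (coord e x).im) :
    ∀ᶠ z in 𝓝[≠] (coord e x), z ∈ puncturedTarget D e := by
  classical
  have h : region e ((D.erase x : Finset X) : Set X)ᶜ ∈ 𝓝 (coord e x) :=
    region_mem_nhds (isOpen_compl_finset _) (coord_mem_region hx (by simp)) h0
  filter_upwards [self_mem_nhdsWithin, nhdsWithin_le_nhds h] with z hz1 hz2
  refine ⟨hz2.1, fun hzD => hz2.2 ?_⟩
  refine Finset.mem_coe.2 (Finset.mem_erase.2 ⟨fun h => hz1 ?_, hzD⟩)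
  rw [Set.mem_singleton_iff, ← h, (coord e).right_inv hz2.1]

theorem PoleForm.differentiableWithinAt [ChartedSpace HalfPlane X] {p q : ℕ} (β : PoleForm X D p q)
    (he : e ∈ atlas HalfPlane X) {z : ℂ} (hz : z ∈ puncturedTarget D e) :
    DifferentiableWithinAt ℝ (β.coeff e) upperHalf z :=
  ((β.smooth e he).differentiableOn (by simp) z hz).mono_of_mem_nhdsWithin
    (puncturedTarget_mem_nhdsWithin hz)

end Separated

variable [ChartedSpace HalfPlane X] [IsManifold complexModel ∞ X]

theorem contDiffOn_conj_transitionDeriv (he : e ∈ atlas HalfPlane X)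
    (he' : e' ∈ atlas HalfPlane X) :
    ContDiffOn ℝ ∞ (fun z => conj (transitionDeriv e e' z)) (region e e'.source) :=
  Complex.conjCLE.contDiff.comp_contDiffOn ((contDiffOn_transitionDeriv he he').restrict_scalars ℝ)

theorem analyticAt_transition (he : e ∈ atlas HalfPlane X) (he' : e' ∈ atlas HalfPlane X) {z : ℂ}
    (hz : z ∈ region e e'.source) (h0 : 0 < z.im) : AnalyticAt ℂ (transition e e') z := by
  refine ((contDiffOn_transition he he').differentiableOn (by simp)).analyticAt ?_
  exact region_mem_nhds e'.open_source hz h0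

/-- The transformation rule for `∂ (g dz̄)`. -/
theorem wirtinger_transform (he : e ∈ atlas HalfPlane X) (he' : e' ∈ atlas HalfPlane X)
    {g g' : ℂ → ℂ} {z : ℂ} (hz : z ∈ region e e'.source)
    (hg' : DifferentiableWithinAt ℝ g' upperHalf (transition e e' z))
    (h : ∀ᶠ w in 𝓝[upperHalf] z, g w = g' (transition e e' w) * conj (transitionDeriv e e' w)) :
    wirtinger g z = wirtinger g' (transition e e' z)
      * transitionDeriv e e' z * conj (transitionDeriv e e' z) := by
  have hzH := coord_target_subset _ hz.1
  have hO := region_mem_nhdsWithin e'.open_source hz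
  have hφ := hasDerivWithinAt_transition he he' hz
  have hm : ∀ᶠ w in 𝓝[upperHalf] z, transition e e' w ∈ upperHalf := by
    filter_upwards [hO] with w hw using coord_target_subset _ (transition_mem_target hw)
  have hψ : DifferentiableWithinAt ℂ (transitionDeriv e e') upperHalf z :=
    ((contDiffOn_transitionDeriv he he').differentiableOn (by simp) z hz).mono_of_mem_nhdsWithin hO
  have hψ' : DifferentiableWithinAt ℝ (fun w => conj (transitionDeriv e e' w)) upperHalf z :=
    ((contDiffOn_conj_transitionDeriv he he').differentiableOn (by simp) z
      hz).mono_of_mem_nhdsWithin hO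
  have hcomp : DifferentiableWithinAt ℝ (fun w => g' (transition e e' w)) upperHalf z := by
    have h1 : DifferentiableWithinAt ℝ (transition e e')
        {w | w ∈ upperHalf ∧ transition e e' w ∈ upperHalf} z :=
      (hφ.differentiableWithinAt.restrictScalars ℝ).mono fun w hw => hw.1
    exact (hg'.comp z h1 fun w hw => hw.2).mono_of_mem_nhdsWithin
      (Filter.inter_mem self_mem_nhdsWithin hm)
  -- By the product rule only g' ∘ φ is differentiated, since conj φ' is antiholomorphic; the chain
  -- rule supplies the extra factor φ'.
  rw [wirtinger_congr h hzH, wirtinger_mul hcomp hψ' hzH, wirtinger_comp hg' hφ hzH hm,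
    wirtinger_conj_of_hasDerivWithinAt hψ.hasDerivWithinAt hzH]
  ring

variable [T2Space X]

/-- The order of a pole does not depend on the chart. -/
theorem PoleForm.hasPoleLE_of_chart {p q : ℕ} (α : PoleForm X D p q)
    (he : e ∈ atlas HalfPlane X) (he' : e' ∈ atlas HalfPlane X) {x : X}
    (hx : x ∈ e.source) (hx' : x ∈ e'.source) (h0 : 0 < (coord e x).im) {n : ℕ}
    (h : HasPoleLE (α.coeff e') (coord e' x) n) : HasPoleLE (α.coeff e) (coord e x) n := by
  have hr : coord e x ∈ region e e'.source := coord_mem_region hx hx'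
  have hO : region e e'.source ∈ 𝓝 (coord e x) := region_mem_nhds e'.open_source hr h0
  have h1 : HasPoleLE (fun z => α.coeff e' (transition e e' z)) (coord e x) n := by
    refine HasPoleLE.comp (by rwa [transition_coord hx]) (analyticAt_transition he he' hr h0) ?_
    rw [deriv_transition h0]
    exact transitionDeriv_ne_zero he he' hr
  have h2 : ContDiffAt ℝ ∞ (transitionDeriv e e') (coord e x) :=
    ((contDiffOn_transitionDeriv he he').restrict_scalars ℝ).contDiffAt hO
  have h3 := (contDiffOn_conj_transitionDeriv he he').contDiffAt hO
  refine ((h1.mul_smooth (h2.pow p)).mul_smooth (h3.pow q)).congr ?_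
  filter_upwards [punctured_eventually (D := D) hx h0, nhdsWithin_le_nhds hO] with z hz hz'
  exact α.compatible e he e' he' z hz hz'.2

/-- The difference of two forms. -/
def PoleForm.sub {p q : ℕ} (α β : PoleForm X D p q) : PoleForm X D p q where
  coeff e z := α.coeff e z - β.coeff e z
  compatible e he e' he' z hz hz' := by
    rw [α.compatible e he e' he' z hz hz', β.compatible e he e' he' z hz hz']
    ring
  smooth e he := (α.smooth e he).sub (β.smooth e he)
  pole e he x hxD hx := by
    obtain ⟨n, hn⟩ := α.pole e he x hxD hx
    obtain ⟨m, hm⟩ := β.pole e he x hxD hx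
    exact ⟨max n m, (hn.mono (le_max_left _ _)).sub (hm.mono (le_max_right _ _))⟩

/-- The sum of a finite family of forms. -/
def PoleForm.sum {p q : ℕ} {ι : Type*} (s : Finset ι) (β : ι → PoleForm X D p q) :
    PoleForm X D p q where
  coeff e z := ∑ i ∈ s, (β i).coeff e z
  compatible e he e' he' z hz hz' := by
    rw [Finset.sum_mul, Finset.sum_mul]
    exact Finset.sum_congr rfl fun i _ => (β i).compatible e he e' he' z hz hz'
  smooth e he := ContDiffOn.sum fun i _ => (β i).smooth e he
  pole e he x hxD hx := HasPoleLE.sum s fun i => (β i).pole e he x hxD hx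

theorem PoleForm.wirtinger_compatible (β : PoleForm X D 0 1) (he : e ∈ atlas HalfPlane X)
    (he' : e' ∈ atlas HalfPlane X) {z : ℂ} (hz : z ∈ puncturedTarget D e)
    (hz' : (coord e).symm z ∈ e'.source) :
    wirtinger (β.coeff e) z = wirtinger (β.coeff e') (transition e e' z)
      * transitionDeriv e e' z * conj (transitionDeriv e e' z) := by
  refine wirtinger_transform he he' ⟨hz.1, hz'⟩
    (β.differentiableWithinAt he' (mem_puncturedTarget_transition hz hz')) ?_
  filter_upwards [puncturedTarget_mem_nhdsWithin hz, overlap_mem_nhdsWithin hz hz'] with w hw hw'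
  simpa using β.compatible e he e' he' w hw hw'.2

/-- The form `∂β`. -/
def PoleForm.del (hD : Disjoint (D : Set X) (complexModel.boundary X)) (β : PoleForm X D 0 1) :
    PoleForm X D 1 1 where
  coeff e := wirtinger (β.coeff e)
  compatible e he e' he' z hz hz' := by
    simpa using β.wirtinger_compatible he he' hz hz'
  smooth e he := by
    have h := β.smooth e he
    obtain ⟨U, hU, hUe⟩ := exists_region_eq e (isOpen_compl_finset D)
    rw [← puncturedTarget_eq_region] at hUe
    exact ContDiffOn.wirtinger hU hUe h
  pole e he x hxD hx := by
    obtain ⟨n, hn⟩ := β.pole e he x hxD hx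
    exact ⟨n + 1, hn.wirtinger (coord_im_pos hD he hxD hx)⟩

/-- The `(0,1)`-form that is `G dz̄` in the chart `e₀` and zero elsewhere. -/
def extendForm (hD : Disjoint (D : Set X) (complexModel.boundary X))
    (he₀ : e₀ ∈ atlas HalfPlane X) (G : ℂ → ℂ) (K : Set ℂ) (hK : IsCompact K)
    (hKe : K ⊆ (coord e₀).target) (hGK : ∀ z ∉ K, G z = 0)
    (hG : ContDiffOn ℝ ∞ G (puncturedTarget D e₀))
    (hp : ∀ x ∈ D, x ∈ e₀.source → ∃ n, HasPoleLE G (coord e₀ x) n) : PoleForm X D 0 1 where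
  coeff := extendCoeff e₀ G
  compatible e he e' he' z hz hz' := by
    have hr : z ∈ region e e'.source := ⟨hz.1, hz'⟩
    by_cases h : (coord e).symm z ∈ e₀.source
    · rw [extendCoeff_of_mem h, extendCoeff_of_mem (by rwa [coord_symm_transition hr]),
        transition_transition hr, transitionDeriv_comp he he' he₀ hr ⟨hz.1, h⟩]
      simp
      ring
    · rw [extendCoeff, extendCoeff, if_neg h, if_neg (by rwa [coord_symm_transition hr])]
      simp
  smooth e he := by
    intro z hz
    have hzV := hz
    rw [puncturedTarget_eq_region] at hzV
    by_cases h : (coord e).symm z ∈ e₀.source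
    · have hO : puncturedTarget D e ∩ region e e₀.source ∈ 𝓝[puncturedTarget D e] z :=
        Filter.inter_mem self_mem_nhdsWithin
          (nhdsWithin_mono z puncturedTarget_subset_upperHalf (overlap_mem_nhdsWithin hz h))
      have h1 : ContDiffOn ℝ ∞ (fun w => G (transition e e₀ w) * conj (transitionDeriv e e₀ w))
          (puncturedTarget D e ∩ region e e₀.source) :=
        (hG.comp ((contDiffOn_transition_real he he₀).mono Set.inter_subset_right)
          fun w hw => mem_puncturedTarget_transition hw.1 hw.2.2).mul
          ((contDiffOn_conj_transitionDeriv he he₀).mono Set.inter_subset_right)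
      exact ((h1.congr fun w hw => extendCoeff_of_mem hw.2.2) z
        ⟨hz, hz.1, h⟩).mono_of_mem_nhdsWithin hO
    -- Outside the domain of `e₀` the point also avoids the image of `K`, which is compact and hence
    -- closed in the Hausdorff space `X`. So the coefficient vanishes in a whole neighbourhood.
    · have hz2 : z ∈ region e ((coord e₀).symm '' K)ᶜ := ⟨hz.1, by
        rintro ⟨w, hw, hw'⟩
        exact h (hw' ▸ coord_symm_mem (hKe hw))⟩
      have hn := nhdsWithin_mono z (puncturedTarget_subset_upperHalf (D := D) (e := e))
        (region_mem_nhdsWithin (isClosed_coord_symm_image hK hKe).isOpen_compl hz2)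
      refine (contDiffWithinAt_const (c := (0 : ℂ))).congr_of_eventuallyEq ?_
        (extendCoeff_eq_zero hGK hz2.2)
      filter_upwards [hn] with w hw using extendCoeff_eq_zero hGK hw.2
  pole e he x hxD hx := by
    have h0 := coord_im_pos hD he hxD hx
    by_cases h : x ∈ e₀.source
    · obtain ⟨n, hn⟩ := hp x hxD h
      have hr : coord e x ∈ region e e₀.source := coord_mem_region hx h
      have hO : region e e₀.source ∈ 𝓝 (coord e x) := region_mem_nhds e₀.open_source hr h0
      have h1 : HasPoleLE (fun z => G (transition e e₀ z)) (coord e x) n := by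
        refine HasPoleLE.comp (by rwa [transition_coord hx])
          (analyticAt_transition he he₀ hr h0) ?_
        rw [deriv_transition h0]
        exact transitionDeriv_ne_zero he he₀ hr
      refine ⟨n, (h1.mul_smooth
        ((contDiffOn_conj_transitionDeriv he he₀).contDiffAt hO)).congr ?_⟩
      filter_upwards [nhdsWithin_le_nhds hO] with z hz using extendCoeff_of_mem hz.2
    · have hx2 : coord e x ∈ region e ((coord e₀).symm '' K)ᶜ := coord_mem_region hx (by
        rintro ⟨w, hw, hw'⟩
        exact h (hw' ▸ coord_symm_mem (hKe hw)))
      refine ⟨0, (HasPoleLE.of_contDiffAt (contDiffAt_const (c := (0 : ℂ)))).congr ?_⟩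
      filter_upwards [nhdsWithin_le_nhds (region_mem_nhds
        (isClosed_coord_symm_image hK hKe).isOpen_compl hx2 h0)] with z hz
      exact extendCoeff_eq_zero hGK hz.2

/-! ### Existence of a splitting. -/

/-- A form that cancels the higher order part of the pole of `θ` at `p` and is smooth elsewhere. -/
theorem exists_local_primitive (hD : Disjoint (D : Set X) (complexModel.boundary X))
    (θ : PoleForm X D 1 1) {p : X} (hp : p ∈ D) :
    ∃ β : PoleForm X D 0 1,
      HasPoleLE (fun z => θ.coeff (chartAt HalfPlane p) z
        - wirtinger (β.coeff (chartAt HalfPlane p)) z) (coord (chartAt HalfPlane p) p) 1 ∧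
      ∀ x ∈ D, x ≠ p → ∀ e, x ∈ e.source → 0 < (coord e x).im →
        β.coeff e =ᶠ[𝓝 (coord e x)] 0 := by
  classical
  set e₀ := chartAt HalfPlane p
  have he₀ : e₀ ∈ atlas HalfPlane X := chart_mem_atlas _ _
  have hpe : p ∈ e₀.source := mem_chart_source _ _
  have h0 := coord_im_pos hD he₀ hp hpe
  obtain ⟨n, hn⟩ := θ.pole e₀ he₀ p hp hpe
  have hs : SmoothNear (θ.coeff e₀) (coord e₀ p) := by
    filter_upwards [punctured_eventually (D := D) hpe h0,
      (eventually_im_pos h0).filter_mono nhdsWithin_le_nhds] with z hz hz0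
    refine (θ.smooth e₀ he₀).contDiffAt ?_
    rw [← nhdsWithin_eq_nhds.2 (halfPlane_mem_nhds hz0)]
    exact puncturedTarget_mem_nhdsWithin hz
  obtain ⟨g, hg, ⟨m, hgm⟩, hθg⟩ := exists_log_pole h0 hn hs
  -- The support of the cutoff is kept away from the other points of `D`, so the form is zero near
  -- them.
  have hU : region e₀ ((D.erase p : Finset X) : Set X)ᶜ ∈ 𝓝 (coord e₀ p) :=
    region_mem_nhds (isOpen_compl_finset _) (coord_mem_region hpe (by simp)) h0
  obtain ⟨G, K, hK, hKU, hGK, hGs, hGg⟩ := exists_cutoff hg hU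
  have hKe : K ⊆ (coord e₀).target := fun z hz => (hKU hz).1
  let β : PoleForm X D 0 1 := extendForm hD he₀ G K hK hKe hGK (by
    intro z hz
    refine (hGs z fun h => hz.2 ?_).contDiffWithinAt
    rw [h, coord_left_inv hpe]
    exact hp) (by
    intro x hx hxe
    by_cases hxp : x = p
    · subst hxp
      exact ⟨m, hgm.congr (hGg.filter_mono nhdsWithin_le_nhds)⟩
    · refine ⟨0, .of_contDiffAt (hGs _ fun h => hxp ?_)⟩
      rw [← coord_left_inv hxe, h, coord_left_inv hpe])
  refine ⟨β, hθg.congr ?_, fun x hx hxp e hxe hx0 => ?_⟩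
  · have h1 : β.coeff e₀ =ᶠ[𝓝 (coord e₀ p)] g := by
      filter_upwards [hU, hGg] with z hz hz'
      rw [← hz']
      exact extendCoeff_self hz.1
    filter_upwards [h1.eventually_nhds.filter_mono nhdsWithin_le_nhds] with z hz
    rw [wirtinger_congr_nhds hz]
  · have hx2 : coord e x ∈ region e ((coord e₀).symm '' K)ᶜ := coord_mem_region hxe (by
      rintro ⟨w, hw, hw'⟩
      exact (hKU hw).2 (by rw [hw']; simp [hx, hxp]))
    filter_upwards [region_mem_nhds (isClosed_coord_symm_image hK hKe).isOpen_compl hx2 hx0]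
      with z hz
    exact extendCoeff_eq_zero hGK hz.2

/-- The local primitives are added up. Near a point x of `D` all summands but the one belonging to x
vanish, so θ - ∂β has there the pole left over by that single correction, in a fixed chart and hence
in every chart. -/
theorem exists_splitting (hD : Disjoint (D : Set X) (complexModel.boundary X))
    (θ : PoleForm X D 1 1) :
    ∃ (α : PoleForm X D 1 1) (β : PoleForm X D 0 1), IsLogarithmic α ∧ IsSplitting θ α β := by
  classical
  have : Nonempty (PoleForm X D 0 1) := ⟨PoleForm.sum (∅ : Finset Empty) Empty.elim⟩
  choose! b hb hb' using fun p (hp : p ∈ D) => exists_local_primitive hD θ hp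
  let β := PoleForm.sum D b
  refine ⟨θ.sub (β.del hD), β, ?_, fun e _ z _ => by simp [PoleForm.sub, PoleForm.del]⟩
  intro e he x hxD hx
  have hx' : x ∈ (chartAt HalfPlane x).source := mem_chart_source _ _
  have hc : chartAt HalfPlane x ∈ atlas HalfPlane X := chart_mem_atlas _ _
  refine PoleForm.hasPoleLE_of_chart _ he hc hx hx' (coord_im_pos hD he hxD hx) ?_
  have h0 := coord_im_pos hD hc hxD hx'
  refine (hb x hxD).congr ?_
  have h1 : β.coeff (chartAt HalfPlane x)
      =ᶠ[𝓝 (coord (chartAt HalfPlane x) x)] (b x).coeff (chartAt HalfPlane x) := by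
    have h2 : ∀ᶠ z in 𝓝 (coord (chartAt HalfPlane x) x), ∀ p ∈ D.erase x,
        (b p).coeff (chartAt HalfPlane x) z = 0 := by
      rw [Filter.eventually_all_finset]
      intro p hp
      have hp' := Finset.mem_erase.1 hp
      exact hb' p hp'.2 x hxD hp'.1.symm _ hx' h0
    filter_upwards [h2] with z hz
    change ∑ p ∈ D, (b p).coeff (chartAt HalfPlane x) z = _
    rw [← Finset.add_sum_erase D _ hxD, Finset.sum_eq_zero hz, add_zero]
  filter_upwards [h1.eventually_nhds.filter_mono nhdsWithin_le_nhds] with z hz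
  change θ.coeff _ z - wirtinger (β.coeff _) z = _
  rw [wirtinger_congr_nhds hz]

end Forms

/-! ### Integrability of simple poles and Stokes' theorem in the half plane. -/

section PlaneIntegrals

open MeasureTheory

/-- In polar coordinates the area factor cancels 1/|z - a|, and the radial integrand becomes the
constant 1 on (0, r]. -/
theorem integrableOn_inv_sub (a : ℂ) (r : ℝ) :
    IntegrableOn (fun z : ℂ => (z - a)⁻¹) (Metric.closedBall a r) := by
  have h0 : Integrable (fun z : ℂ => (Set.Iic r).indicator (fun y : ℝ => y⁻¹) ‖z‖) := by
    rw [integrable_fun_norm_addHaar (volume : Measure ℂ) (f := (Set.Iic r).indicator fun y => y⁻¹)]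
    have h1 : IntegrableOn (fun _ : ℝ => (1 : ℝ)) (Set.Ioc 0 r) := by
      rw [integrableOn_const_iff]; simp
    have h2 : IntegrableOn ((Set.Ioc 0 r).indicator fun _ : ℝ => (1 : ℝ)) (Set.Ioi 0) :=
      (h1.integrable_indicator measurableSet_Ioc).integrableOn
    refine h2.congr_fun (fun y hy => ?_) measurableSet_Ioi
    have hy' : (0 : ℝ) < y := hy
    by_cases hyr : y ≤ r
    · simp [Set.indicator, hyr, hy', hy'.ne']
    · simp [Set.indicator, hyr]
  have h1 := (h0.comp_sub_right a)
  rw [← integrable_indicator_iff Metric.isClosed_closedBall.measurableSet]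
  refine h1.mono' ?_ (ae_of_all _ fun z => ?_)
  · exact ((measurable_id.sub_const a).inv.indicator
      Metric.isClosed_closedBall.measurableSet).aestronglyMeasurable
  · by_cases hz : z ∈ Metric.closedBall a r
    · have : ‖z - a‖ ≤ r := by simpa [dist_eq_norm] using hz
      simp [Set.indicator, hz, this]
    · have : ¬ ‖z - a‖ ≤ r := by simpa [dist_eq_norm] using hz
      simp [Set.indicator, hz, this]

theorem HasPoleLE.integrableAtFilter {f : ℂ → ℂ} {a : ℂ} (hf : HasPoleLE f a 1) :
    IntegrableAtFilter f (𝓝 a) := by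
  obtain ⟨h, hh, hfh⟩ := hf
  rw [eventually_nhdsWithin_iff] at hfh
  obtain ⟨r, hr, hrU⟩ := Metric.nhds_basis_closedBall.mem_iff.1
    (Filter.inter_mem (ContDiffAt.eventually_differentiableAt hh) hfh)
  refine ⟨Metric.closedBall a r, Metric.closedBall_mem_nhds a hr, ?_⟩
  have h1 : ContinuousOn h (Metric.closedBall a r) := fun z hz =>
    (hrU hz).1.continuousAt.continuousWithinAt
  have h2 := (integrableOn_inv_sub a r).continuousOn_mul h1 (isCompact_closedBall a r)
  refine h2.congr ?_
  rw [Filter.EventuallyEq, ae_restrict_iff' Metric.isClosed_closedBall.measurableSet]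
  have h3 : ∀ᵐ z : ℂ, z ≠ a := by simp [ae_iff]
  filter_upwards [h3] with z hza hz
  rw [(hrU hz).2 hza, pow_one, div_eq_mul_inv]

theorem integral_rectangle {G : ℂ → ℂ} {R : ℝ} (hR : 0 ≤ R)
    (hG : IntegrableOn G (Set.uIcc (-R) R ×ℂ Set.uIcc 0 R)) :
    ∫ x in (-R)..R, ∫ y in (0 : ℝ)..R, G (x + y * Complex.I)
      = ∫ z in Set.uIcc (-R) R ×ℂ Set.uIcc 0 R, G z := by
  have hmp := Complex.volume_preserving_equiv_real_prod.symm
  have hpre : Complex.measurableEquivRealProd.symm ⁻¹' (Set.uIcc (-R) R ×ℂ Set.uIcc 0 R)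
      = Set.uIcc (-R) R ×ˢ Set.uIcc 0 R := rfl
  have hG' := (hmp.integrableOn_comp_preimage
    (MeasurableEquiv.measurableEmbedding _)).2 hG
  rw [← hmp.setIntegral_preimage_emb (MeasurableEquiv.measurableEmbedding _), hpre,
    Measure.volume_eq_prod, setIntegral_prod _ (by rw [hpre] at hG'; exact hG'),
    Set.uIcc_of_le (by linarith : -R ≤ R), Set.uIcc_of_le hR, integral_Icc_eq_integral_Ioc,
    intervalIntegral.integral_of_le (by linarith : -R ≤ R)]
  refine integral_congr_ae (ae_of_all _ fun x => ?_)
  simp only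
  rw [integral_Icc_eq_integral_Ioc, intervalIntegral.integral_of_le hR]
  refine integral_congr_ae (ae_of_all _ fun y => ?_)
  exact congrArg G (Complex.mk_eq_add_mul_I x y).symm

/-- Stokes' theorem for compactly supported `(0,1)`-forms on the closed upper half plane. -/
theorem integral_wirtinger_halfPlane {f : ℂ → ℂ} (hf : ContDiffOn ℝ ∞ f upperHalf) {K : Set ℂ}
    (hK : IsCompact K) (h0 : ∀ z ∉ K, f z = 0) :
    ∫ z in upperHalf, wirtinger f z * (-2 * Complex.I) = ∫ x : ℝ, f x := by
  obtain ⟨R, hRpos, hR⟩ : ∃ R > 0, K ⊆ Metric.ball 0 R := by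
    obtain ⟨R, hR⟩ := hK.isBounded.subset_ball 0
    exact ⟨max R 1, by positivity, hR.trans (Metric.ball_subset_ball (le_max_left _ _))⟩
  have hfR : ∀ z : ℂ, R ≤ ‖z‖ → f z = 0 := fun z hz => h0 z fun h => by
    have := hR h
    rw [mem_ball_zero_iff] at this
    linarith
  set W : ℂ → ℂ := fun z => wirtinger f z * (-2 * Complex.I)
  have hW0 : ∀ z : ℂ, R ≤ ‖z‖ → W z = 0 := by
    intro z hz
    have hzK : z ∉ K := fun h => by
      have := hR h
      rw [mem_ball_zero_iff] at this
      linarith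
    have : f =ᶠ[𝓝 z] fun _ => 0 := by
      filter_upwards [hK.isClosed.isOpen_compl.mem_nhds hzK] with w hw using h0 w hw
    simp only [W]
    rw [wirtinger_congr_nhds this]
    simp [wirtinger]
  have hWc : ContinuousOn W upperHalf :=
    (ContDiffOn.wirtinger isOpen_univ (Set.univ_inter _).symm hf).continuousOn.mul
      continuousOn_const
  set Q : Set ℂ := Set.uIcc (-R) R ×ℂ Set.uIcc 0 R
  have hQc : IsCompact Q := isCompact_uIcc.reProdIm isCompact_uIcc
  have hQH : Q ⊆ upperHalf := by
    intro z hz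
    have := (Complex.mem_reProdIm.1 hz).2
    rw [Set.uIcc_of_le hRpos.le] at this
    exact this.1
  have hQ0 : ∀ z ∈ upperHalf \ Q, W z = 0 := by
    rintro z ⟨hz1, hz2⟩
    refine hW0 z (le_of_not_gt fun h => hz2 ?_)
    refine Complex.mem_reProdIm.2 ⟨?_, ?_⟩
    · rw [Set.uIcc_of_le (by linarith : -R ≤ R)]
      exact abs_le.1 ((Complex.abs_re_le_norm z).trans h.le)
    · rw [Set.uIcc_of_le hRpos.le]
      exact ⟨hz1, (le_abs_self _).trans ((Complex.abs_im_le_norm z).trans h.le)⟩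
  have hWQ : IntegrableOn W Q := (hWc.mono hQH).integrableOn_compact hQc
  -- The rectangle formula concerns ∂/∂z̄, while ∂/∂z is needed. Since ∂(conj f)/∂z̄ is the
  -- conjugate of ∂f/∂z, it is applied to conj f, whose differential is `L`.
  set L : ℂ → ℂ →L[ℝ] ℂ := fun z =>
    Complex.conjCLE.toContinuousLinearMap.comp (fderivWithin ℝ f upperHalf z)
  have hL : ∀ z, Complex.I • L z 1 - L z Complex.I = conj (W z) := by
    intro z
    simp only [L, W, wirtinger, ContinuousLinearMap.coe_comp, Function.comp,
      ContinuousLinearEquiv.coe_coe, Complex.conjCLE_apply, smul_eq_mul, map_mul, map_div₀,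
      map_sub, map_neg, Complex.conj_I, map_ofNat]
    linear_combination (-conj (fderivWithin ℝ f upperHalf z Complex.I)) * Complex.I_mul_I
  -- The formula asks for differentiability only in the open rectangle and for continuity on the
  -- closed one, so the side on the real axis needs no extension of f below it.
  have key := Complex.integral_boundary_rect_of_hasFDerivAt_real_off_countable
    (fun z => conj (f z)) L (-R : ℝ) (R + R * Complex.I) ∅ Set.countable_empty
    (by
      refine Complex.continuous_conj.comp_continuousOn (hf.continuousOn.mono ?_)
      simpa using hQH)
    (by
      rintro z ⟨hz, -⟩
      have hz0 : 0 < z.im := by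
        have := (Complex.mem_reProdIm.1 hz).2.1
        simpa [hRpos.le] using this
      have h1 := ((hf.differentiableOn (by simp)) z hz0.le).hasFDerivWithinAt.hasFDerivAt
        (halfPlane_mem_nhds hz0)
      exact Complex.conjCLE.toContinuousLinearMap.hasFDerivAt.comp z h1)
    (by
      simp only [hL]
      have : IntegrableOn (fun z => conj (W z)) Q :=
        (Complex.continuous_conj.comp_continuousOn (hWc.mono hQH)).integrableOn_compact hQc
      simpa using this)
  simp only [hL] at key
  simp only [Complex.ofReal_re, Complex.ofReal_im, Complex.add_re, Complex.add_im,
    Complex.mul_re, Complex.mul_im, Complex.I_re, Complex.I_im, mul_zero, mul_one, zero_add,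
    add_zero, sub_zero, Complex.ofReal_zero, zero_mul] at key
  -- The support lies in the ball of radius R, so three sides contribute nothing and only the real
  -- axis survives.
  have htop : ∀ x : ℝ, f (x + R * Complex.I) = 0 := fun x => hfR _ (by
    refine le_trans (le_of_eq ?_) (Complex.abs_im_le_norm _)
    simp [abs_of_pos hRpos])
  have hright : ∀ y : ℝ, f (R + y * Complex.I) = 0 := fun y => hfR _ (by
    refine le_trans (le_of_eq ?_) (Complex.abs_re_le_norm _)
    simp [abs_of_pos hRpos])
  have hleft : ∀ y : ℝ, f ((-R : ℝ) + y * Complex.I) = 0 := fun y => hfR _ (by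
    refine le_trans (le_of_eq ?_) (Complex.abs_re_le_norm _)
    simp [abs_of_pos hRpos])
  simp only [htop, hright, hleft, map_zero, intervalIntegral.integral_zero, smul_zero, sub_zero,
    add_zero] at key
  rw [integral_rectangle (G := fun z => conj (W z)) hRpos.le (by
    exact (Complex.continuous_conj.comp_continuousOn (hWc.mono hQH)).integrableOn_compact hQc),
    integral_conj, intervalIntegral.integral_of_le (by linarith), integral_conj] at key
  have key' := (starRingEnd ℂ).injective key
  rw [setIntegral_eq_of_subset_of_forall_sdiff_eq_zero isClosed_halfPlane.measurableSet hQH hQ0,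
    ← key', ← integral_Icc_eq_integral_Ioc, setIntegral_eq_integral_of_forall_compl_eq_zero]
  intro x hx
  refine hfR _ (le_of_not_gt fun h => hx ?_)
  rw [Complex.norm_real] at h
  exact abs_le.1 h.le

end PlaneIntegrals

/-! ### Independence of local integrals from the chart. -/

section ChangeOfVariables

open MeasureTheory

variable {X : Type*} [TopologicalSpace X] {D : Finset X}
  {e e' : OpenPartialHomeomorph X HalfPlane}

/-- Finitely many points form a null set, so the arbitrary values of coefficients over `D` never
affect an area integral. -/
theorem ae_mem_puncturedTarget (D : Finset X) (e : OpenPartialHomeomorph X HalfPlane) :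
    ∀ᵐ z : ℂ, z ∈ (coord e).target → z ∈ puncturedTarget D e := by
  have h : (coord e '' (D : Set X)).Finite := D.finite_toSet.image _
  filter_upwards [measure_eq_zero_iff_ae_notMem.1 (h.measure_zero volume)] with z hz hze
  exact ⟨hze, fun hzD => hz ⟨_, hzD, (coord e).right_inv hze⟩⟩

/-- The determinant of multiplication by c over ℝ is the norm of c from ℂ to ℝ. For c = φ' it is φ'
· conj φ', the factor by which (1,1)-forms transform. -/
theorem abs_det_toSpanSingleton (c : ℂ) :
    |((ContinuousLinearMap.toSpanSingleton ℂ c).restrictScalars ℝ).det| = Complex.normSq c := by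
  have : ((ContinuousLinearMap.toSpanSingleton ℂ c).restrictScalars ℝ).det = Complex.normSq c := by
    simp [ContinuousLinearMap.det, LinearMap.det_restrictScalars, Algebra.norm_complex_eq,
      Complex.normSq_eq_norm_sq]
  rw [this, abs_of_nonneg (Complex.normSq_nonneg c)]

/-- The boundary points of the coordinate domain of `e` that lie over `V`. -/
def boundaryRegion (e : OpenPartialHomeomorph X HalfPlane) (V : Set X) : Set ℝ :=
  {x | (x : ℂ) ∈ region e V}

theorem measurableSet_boundaryRegion (e : OpenPartialHomeomorph X HalfPlane) {V : Set X}
    (hV : IsOpen V) : MeasurableSet (boundaryRegion e V) :=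
  Complex.measurable_ofReal (measurableSet_region e hV)

theorem measurableSet_boundaryTarget (e : OpenPartialHomeomorph X HalfPlane) :
    MeasurableSet (boundaryTarget e) :=
  Complex.measurable_ofReal (measurableSet_target e)

theorem isCompact_coord_image [CompactSpace X] {S : Set X} (hS : IsClosed S) (hSe : S ⊆ e.source) :
    IsCompact (coord e '' S) :=
  hS.isCompact.image_of_continuousOn (e.continuousOn_extend.mono (by
    rw [OpenPartialHomeomorph.extend_source]; exact hSe))

theorem coord_image_subset {S : Set X} (hSe : S ⊆ e.source) : coord e '' S ⊆ (coord e).target := by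
  rintro _ ⟨x, hx, rfl⟩
  exact coord_mem (hSe hx)

theorem coord_symm_notMem {S : Set X} {z : ℂ} (hz : z ∈ (coord e).target \ coord e '' S) :
    (coord e).symm z ∉ S :=
  fun h => hz.2 ⟨_, h, (coord e).right_inv hz.1⟩

/-- Local integrability suffices: at `D` the pole has order at most one, and elsewhere the
coefficient is continuous. -/
theorem PoleForm.integrableOn_compact [T2Space X] [ChartedSpace HalfPlane X] {α : PoleForm X D 1 1} (hα : IsLogarithmic α)
    (he : e ∈ atlas HalfPlane X) {K : Set ℂ} (hK : IsCompact K) (hKe : K ⊆ (coord e).target) :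
    IntegrableOn (α.coeff e) K := by
  refine LocallyIntegrableOn.integrableOn_isCompact (fun z hz => ?_) hK
  have hze := hKe hz
  by_cases hzD : (coord e).symm z ∈ D
  · have h1 := hα e he _ hzD (coord_symm_mem hze)
    rw [(coord e).right_inv hze] at h1
    exact h1.integrableAtFilter.filter_mono nhdsWithin_le_nhds
  · have hzp : z ∈ puncturedTarget D e := ⟨hze, hzD⟩
    have hm : MeasurableSet (puncturedTarget D e) := by
      rw [puncturedTarget_eq_region]
      exact measurableSet_region e (isOpen_compl_finset D)
    refine ((α.smooth e he).continuousOn.integrableAt_nhdsWithin hm hzp).filter_mono ?_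
    rw [nhdsWithin_le_iff]
    exact nhdsWithin_mono z (hKe.trans (coord_target_subset e))
      (puncturedTarget_mem_nhdsWithin hzp)

variable [ChartedSpace HalfPlane X] [IsManifold complexModel ∞ X]

theorem integral_region_eq (D : Finset X) (he : e ∈ atlas HalfPlane X)
    (he' : e' ∈ atlas HalfPlane X) {A A' : ℂ → ℂ}
    (h : ∀ z ∈ puncturedTarget D e, (coord e).symm z ∈ e'.source →
      A z = A' (transition e e' z) * transitionDeriv e e' z * conj (transitionDeriv e e' z)) :
    ∫ z in region e e'.source, A z = ∫ z in region e' e.source, A' z := by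
  have hs := measurableSet_region e e'.open_source
  rw [← image_transition (e := e) (e' := e'),
    integral_image_eq_integral_abs_det_fderiv_smul volume hs
      (fun z hz => ((hasDerivWithinAt_transition he he' hz).hasFDerivWithinAt.restrictScalars
        ℝ).mono fun w (hw : w ∈ region e e'.source) => coord_target_subset _ hw.1)
      injOn_transition]
  refine setIntegral_congr_ae hs ?_
  filter_upwards [ae_mem_puncturedTarget D e] with z hz hzr
  rw [h z (hz hzr.1) hzr.2, abs_det_toSpanSingleton, mul_assoc, Complex.mul_conj,
    Complex.real_smul, mul_comm]

/-- Integrals of `2`-forms supported in two coordinate domains can be computed in either chart. -/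
theorem integral_target_eq (D : Finset X) (he : e ∈ atlas HalfPlane X)
    (he' : e' ∈ atlas HalfPlane X) {A A' : ℂ → ℂ}
    (h : ∀ z ∈ puncturedTarget D e, (coord e).symm z ∈ e'.source →
      A z = A' (transition e e' z) * transitionDeriv e e' z * conj (transitionDeriv e e' z))
    (hA : ∀ z ∈ puncturedTarget D e, (coord e).symm z ∉ e'.source → A z = 0)
    (hA' : ∀ z ∈ puncturedTarget D e', (coord e').symm z ∉ e.source → A' z = 0) :
    ∫ z in (coord e).target, A z = ∫ z in (coord e').target, A' z := by
  rw [setIntegral_eq_of_subset_of_ae_sdiff_eq_zero (measurableSet_target e).nullMeasurableSet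
      (region_subset_target e e'.source), integral_region_eq D he he' h,
    setIntegral_eq_of_subset_of_ae_sdiff_eq_zero (measurableSet_target e').nullMeasurableSet
      (region_subset_target e' e.source)]
  · filter_upwards [ae_mem_puncturedTarget D e'] with z hz hzr
    exact hA' z (hz hzr.1) fun h => hzr.2 ⟨hzr.1, h⟩
  · filter_upwards [ae_mem_puncturedTarget D e] with z hz hzr
    exact hA z (hz hzr.1) fun h => hzr.2 ⟨hzr.1, h⟩

theorem ofReal_transition_re (he : e ∈ atlas HalfPlane X) (he' : e' ∈ atlas HalfPlane X) {x : ℝ}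
    (hx : x ∈ boundaryRegion e e'.source) :
    (((transition e e' x).re : ℝ) : ℂ) = transition e e' x :=
  Complex.ext rfl ((transition_im_eq_zero_iff he he' hx).2 (Complex.ofReal_im x)).symm

theorem image_boundaryRegion (he : e ∈ atlas HalfPlane X) (he' : e' ∈ atlas HalfPlane X) :
    (fun x : ℝ => (transition e e' x).re) '' boundaryRegion e e'.source
      = boundaryRegion e' e.source := by
  apply Set.Subset.antisymm
  · rintro _ ⟨x, hx, rfl⟩
    change ((_ : ℝ) : ℂ) ∈ region _ _
    rw [ofReal_transition_re he he' hx]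
    exact transition_mem hx
  · intro y hy
    have h := ofReal_transition_re he' he hy
    refine ⟨(transition e' e y).re, ?_, ?_⟩
    · change ((_ : ℝ) : ℂ) ∈ region _ _
      rw [h]
      exact transition_mem hy
    · simp only
      rw [h, transition_symm hy, Complex.ofReal_re]

/-- Along the real axis φ' is real and positive, so the factor |φ'| of the substitution rule
coincides with the factor conj φ' of (0,1)-forms. -/
theorem integral_boundaryRegion_eq (he : e ∈ atlas HalfPlane X)
    (he' : e' ∈ atlas HalfPlane X) {B B' : ℝ → ℂ}
    (h : ∀ x ∈ boundaryRegion e e'.source,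
      B x = B' (transition e e' x).re * conj (transitionDeriv e e' x)) :
    ∫ x in boundaryRegion e e'.source, B x = ∫ x in boundaryRegion e' e.source, B' x := by
  have hs := measurableSet_boundaryRegion e e'.open_source
  have hderiv : ∀ x ∈ boundaryRegion e e'.source, HasDerivWithinAt
      (fun x : ℝ => (transition e e' x).re) (transitionDeriv e e' x).re
      (boundaryRegion e e'.source) x := by
    intro x hx
    have h1 := (hasDerivWithinAt_transition he he' hx).hasFDerivWithinAt.restrictScalars ℝ
    have h2 := h1.comp_hasDerivWithinAt (s := boundaryRegion e e'.source) x
      (Complex.ofRealCLM.hasDerivWithinAt) (fun y hy => coord_target_subset e hy.1)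
    have h3 := Complex.reCLM.hasFDerivAt.comp_hasDerivWithinAt x h2
    simpa [Function.comp_def] using h3
  have hinj : Set.InjOn (fun x : ℝ => (transition e e' x).re) (boundaryRegion e e'.source) := by
    intro x hx y hy hxy
    have h1 : transition e e' x = transition e e' y := by
      rw [← ofReal_transition_re he he' hx, ← ofReal_transition_re he he' hy]
      exact congrArg _ hxy
    exact Complex.ofReal_injective (injOn_transition hx hy h1)
  rw [← image_boundaryRegion he he', integral_image_eq_integral_abs_deriv_smul hs hderiv hinj]
  refine setIntegral_congr_fun hs fun x hx => ?_
  obtain ⟨h1, h2⟩ := transitionDeriv_boundary he he' hx (Complex.ofReal_im x)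
  have h3 : transitionDeriv e e' x = ((transitionDeriv e e' x).re : ℂ) := Complex.ext rfl h1
  rw [h x hx, abs_of_pos h2, Complex.real_smul, mul_comm]
  conv_lhs => rw [h3, Complex.conj_ofReal]

/-- Boundary integrals of `(0,1)`-forms supported in two coordinate domains can be computed in
either chart. -/
theorem integral_boundaryTarget_eq (he : e ∈ atlas HalfPlane X)
    (he' : e' ∈ atlas HalfPlane X) {B B' : ℝ → ℂ}
    (h : ∀ x ∈ boundaryRegion e e'.source,
      B x = B' (transition e e' x).re * conj (transitionDeriv e e' x))
    (hB : ∀ x ∈ boundaryTarget e, (coord e).symm x ∉ e'.source → B x = 0)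
    (hB' : ∀ x ∈ boundaryTarget e', (coord e').symm x ∉ e.source → B' x = 0) :
    ∫ x in boundaryTarget e, B x = ∫ x in boundaryTarget e', B' x := by
  rw [setIntegral_eq_of_subset_of_forall_sdiff_eq_zero (measurableSet_boundaryTarget e)
      (fun x (hx : x ∈ boundaryRegion e e'.source) => hx.1), integral_boundaryRegion_eq he he' h,
    setIntegral_eq_of_subset_of_forall_sdiff_eq_zero (measurableSet_boundaryTarget e')
      (fun x (hx : x ∈ boundaryRegion e' e.source) => hx.1)]
  · exact fun x hx => hB' x hx.1 fun h => hx.2 ⟨hx.1, h⟩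
  · exact fun x hx => hB x hx.1 fun h => hx.2 ⟨hx.1, h⟩

end ChangeOfVariables

/-! ### Multiplication by smooth functions, and supports. -/

section Multiplication

open MeasureTheory

variable {X : Type*} [TopologicalSpace X] [ChartedSpace HalfPlane X] [IsManifold complexModel ∞ X]
  {D : Finset X} {e e' : OpenPartialHomeomorph X HalfPlane}

theorem contDiffOn_comp_coord_symm (he : e ∈ atlas HalfPlane X)
    (u : C^∞⟮realModel, X; 𝓘(ℝ), ℝ⟯) :
    ContDiffOn ℝ ∞ (fun z => (u ((coord e).symm z) : ℂ)) (coord e).target := by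
  have := isManifold_real (X := X)
  have h1 := contMDiffOn_extend_symm (I := realModel) (n := ∞)
    (IsManifold.subset_maximalAtlas he)
  rw [← OpenPartialHomeomorph.extend_target'] at h1
  have h2 := (u.contMDiff.comp_contMDiffOn h1).contDiffOn
  exact Complex.ofRealCLM.contDiff.comp_contDiffOn h2

theorem contDiffAt_comp_coord_symm (he : e ∈ atlas HalfPlane X)
    (u : C^∞⟮realModel, X; 𝓘(ℝ), ℝ⟯) {x : X} (hx : x ∈ e.source) (h0 : 0 < (coord e x).im) :
    ContDiffAt ℝ ∞ (fun z => (u ((coord e).symm z) : ℂ)) (coord e x) := by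
  refine (contDiffOn_comp_coord_symm he u).contDiffAt ?_
  rw [← region_univ]
  exact region_mem_nhds isOpen_univ (coord_mem_region hx trivial) h0

/-- The product of a form with a smooth function. -/
def PoleForm.smul {p q : ℕ} (hD : Disjoint (D : Set X) (complexModel.boundary X))
    (u : C^∞⟮realModel, X; 𝓘(ℝ), ℝ⟯) (α : PoleForm X D p q) : PoleForm X D p q where
  coeff e z := (u ((coord e).symm z) : ℂ) * α.coeff e z
  compatible e he e' he' z hz hz' := by
    rw [α.compatible e he e' he' z hz hz', coord_symm_transition ⟨hz.1, hz'⟩]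
    ring
  smooth e he := ((contDiffOn_comp_coord_symm he u).mono fun z hz => hz.1).mul (α.smooth e he)
  pole e he x hxD hx := by
    obtain ⟨n, hn⟩ := α.pole e he x hxD hx
    refine ⟨n, (hn.mul_smooth (contDiffAt_comp_coord_symm he u hx
      (coord_im_pos hD he hxD hx))).congr ?_⟩
    filter_upwards with z using mul_comm _ _

/-- All poles of the form along `D` have order at most `n`. -/
def PoleForm.PolesLE {p q : ℕ} (α : PoleForm X D p q) (n : ℕ) : Prop :=
  ∀ e ∈ atlas HalfPlane X, ∀ x ∈ D, x ∈ e.source → HasPoleLE (α.coeff e) (coord e x) n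

theorem PoleForm.PolesLE.smul {p q n : ℕ} {α : PoleForm X D p q} (hα : α.PolesLE n)
    (hD : Disjoint (D : Set X) (complexModel.boundary X)) (u : C^∞⟮realModel, X; 𝓘(ℝ), ℝ⟯) :
    (α.smul hD u).PolesLE n := by
  intro e he x hxD hx
  refine ((hα e he x hxD hx).mul_smooth (contDiffAt_comp_coord_symm he u hx
    (coord_im_pos hD he hxD hx))).congr ?_
  filter_upwards with z using mul_comm _ _

/-- The form vanishes outside `S`. -/
def PoleForm.SupportedIn {p q : ℕ} (α : PoleForm X D p q) (S : Set X) : Prop :=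
  ∀ e ∈ atlas HalfPlane X, ∀ z ∈ puncturedTarget D e, (coord e).symm z ∉ S → α.coeff e z = 0

theorem PoleForm.supportedIn_smul {p q : ℕ} (α : PoleForm X D p q)
    (hD : Disjoint (D : Set X) (complexModel.boundary X)) (u : C^∞⟮realModel, X; 𝓘(ℝ), ℝ⟯) :
    (α.smul hD u).SupportedIn (tsupport u) := by
  intro e _ z _ hz'
  change (u ((coord e).symm z) : ℂ) * _ = 0
  rw [image_eq_zero_of_notMem_tsupport hz', Complex.ofReal_zero, zero_mul]

/-- This is where `D` being disjoint from the boundary makes boundary integrals harmless: on the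
real axis the coefficients have no poles. -/
theorem mem_puncturedTarget_of_real (hD : Disjoint (D : Set X) (complexModel.boundary X))
    (he : e ∈ atlas HalfPlane X) {x : ℝ} (hx : x ∈ boundaryTarget e) :
    (x : ℂ) ∈ puncturedTarget D e := by
  refine ⟨hx, fun h => ?_⟩
  have := coord_im_pos hD he h (coord_symm_mem hx)
  rw [(coord e).right_inv hx] at this
  simp at this

variable [T2Space X]

/-- `IsLogarithmic` unfolds to `PolesLE 1`, and ∂ raises the bound on the order by one. -/
theorem PoleForm.PolesLE.del {β : PoleForm X D 0 1} (hβ : β.PolesLE 0)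
    (hD : Disjoint (D : Set X) (complexModel.boundary X)) : IsLogarithmic (β.del hD) :=
  fun e he x hxD hx => (hβ e he x hxD hx).wirtinger (coord_im_pos hD he hxD hx)

theorem PoleForm.SupportedIn.del {β : PoleForm X D 0 1} {S : Set X} (hβ : β.SupportedIn S)
    (hS : IsClosed S) (hD : Disjoint (D : Set X) (complexModel.boundary X)) :
    (β.del hD).SupportedIn S := by
  intro e he z hz hzS
  have hzH := puncturedTarget_subset_upperHalf hz
  have h : β.coeff e =ᶠ[𝓝[upperHalf] z] fun _ => 0 := by
    filter_upwards [puncturedTarget_mem_nhdsWithin hz,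
      region_mem_nhdsWithin hS.isOpen_compl ⟨hz.1, hzS⟩] with w hw hw'
    exact hβ e he w hw hw'.2
  change wirtinger (β.coeff e) z = 0
  rw [wirtinger_congr h hzH, wirtinger_const _ hzH]

end Multiplication

/-! ### Global integrals, Stokes' theorem, and independence of the splitting. -/

section Regularization

open MeasureTheory

variable {X : Type*} [TopologicalSpace X] [ChartedSpace HalfPlane X]
  {D : Finset X} {e e' : OpenPartialHomeomorph X HalfPlane}

theorem ChartPartition.sum_eq_one (P : ChartPartition X) (x : X) :
    ∑ i, (P.ρ i x : ℂ) = 1 := by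
  rw [← Complex.ofReal_sum, ← finsum_eq_sum_of_fintype, P.ρ.sum_eq_one (Set.mem_univ x),
    Complex.ofReal_one]

theorem PoleForm.SupportedIn.integrableOn [T2Space X] [CompactSpace X] {α : PoleForm X D 1 1} {S : Set X}
    (hα : α.SupportedIn S) (hlog : IsLogarithmic α) (he : e ∈ atlas HalfPlane X)
    (hS : IsClosed S) (hSe : S ⊆ e.source) : IntegrableOn (α.coeff e) (coord e).target := by
  refine (PoleForm.integrableOn_compact hlog he (isCompact_coord_image hS hSe)
    (coord_image_subset hSe)).of_ae_sdiff_eq_zero (measurableSet_target e).nullMeasurableSet ?_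
  filter_upwards [ae_mem_puncturedTarget D e] with z hz hzK
  exact hα e he z (hz hzK.1) (coord_symm_notMem hzK)

variable [IsManifold complexModel ∞ X]

theorem PoleForm.SupportedIn.smul {p q : ℕ} {α : PoleForm X D p q} {S : Set X}
    (hα : α.SupportedIn S) (hD : Disjoint (D : Set X) (complexModel.boundary X))
    (u : C^∞⟮realModel, X; 𝓘(ℝ), ℝ⟯) : (α.smul hD u).SupportedIn S := by
  intro e he z hz hzS
  change _ * α.coeff e z = 0
  rw [hα e he z hz hzS, mul_zero]

theorem PoleForm.SupportedIn.integrableOn_boundary [CompactSpace X] {β : PoleForm X D 0 1} {S : Set X}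
    (hβ : β.SupportedIn S) (hD : Disjoint (D : Set X) (complexModel.boundary X))
    (he : e ∈ atlas HalfPlane X) (hS : IsClosed S) (hSe : S ⊆ e.source) :
    IntegrableOn (fun x : ℝ => β.coeff e x) (boundaryTarget e) := by
  have hK : IsCompact ((fun x : ℝ => (x : ℂ)) ⁻¹' (coord e '' S)) :=
    Complex.isometry_ofReal.isClosedEmbedding.isCompact_preimage (isCompact_coord_image hS hSe)
  have hc : ContinuousOn (fun x : ℝ => β.coeff e x)
      ((fun x : ℝ => (x : ℂ)) ⁻¹' (coord e '' S)) :=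
    (β.smooth e he).continuousOn.comp Complex.continuous_ofReal.continuousOn fun x hx =>
      mem_puncturedTarget_of_real hD he (coord_image_subset hSe hx)
  refine (hc.integrableOn_compact hK).of_forall_sdiff_eq_zero (measurableSet_boundaryTarget e) ?_
  exact fun x hx => hβ e he x (mem_puncturedTarget_of_real hD he hx.1) (coord_symm_notMem hx)

theorem polesLE_zero_of_del [T2Space X] (hD : Disjoint (D : Set X) (complexModel.boundary X))
    {γ : PoleForm X D 0 1} (h : IsLogarithmic (γ.del hD)) :
    γ.PolesLE 0 := by
  intro e he x hxD hx
  obtain ⟨n, hn⟩ := γ.pole e he x hxD hx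
  exact hn.of_wirtinger_log (coord_im_pos hD he hxD hx) (h e he x hxD hx)

variable [CompactSpace X] (P Q : ChartPartition X)

/-- The integral of a `(0,1)`-form over the boundary, computed with the partition `P`. -/
def boundarySum (P : ChartPartition X) (β : PoleForm X D 0 1) : ℂ :=
  ∑ i, ∫ x in boundaryTarget (P.chart i), boundaryIntegrand P β i x

theorem integrableOn_boundaryIntegrand (hD : Disjoint (D : Set X) (complexModel.boundary X))
    (β : PoleForm X D 0 1) (i : Fin P.n) :
    IntegrableOn (boundaryIntegrand P β i) (boundaryTarget (P.chart i)) :=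
  (β.supportedIn_smul hD (P.ρ i)).integrableOn_boundary hD
    (P.chart_mem i) (isClosed_tsupport _) (P.subordinate i)

theorem boundarySum_eq_sum (hD : Disjoint (D : Set X) (complexModel.boundary X))
    {ι : Type*} [Fintype ι] {β : PoleForm X D 0 1}
    {κ : ι → PoleForm X D 0 1}
    (h : ∀ e ∈ atlas HalfPlane X, ∀ z ∈ puncturedTarget D e,
      β.coeff e z = ∑ j, (κ j).coeff e z) :
    boundarySum P β = ∑ j, boundarySum P (κ j) := by
  simp only [boundarySum]
  rw [Finset.sum_comm]
  refine Finset.sum_congr rfl fun i _ => ?_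
  rw [← integral_finsetSum _ fun j _ => integrableOn_boundaryIntegrand P hD (κ j) i]
  refine setIntegral_congr_fun (measurableSet_boundaryTarget _) fun x hx => ?_
  simp only [boundaryIntegrand]
  rw [h _ (P.chart_mem i) x (mem_puncturedTarget_of_real hD (P.chart_mem i) hx), Finset.mul_sum]

/-- Each ρ_i β is supported in both its own chart and `e`, so it can be integrated in `e`; there the
ρ_i add up to 1. -/
theorem boundarySum_of_supportedIn (hD : Disjoint (D : Set X) (complexModel.boundary X))
    {β : PoleForm X D 0 1} {S : Set X}
    (hS : β.SupportedIn S) (hSc : IsClosed S) (he : e ∈ atlas HalfPlane X) (hSe : S ⊆ e.source) :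
    boundarySum P β = ∫ x in boundaryTarget e, β.coeff e (x : ℂ) := by
  have h1 : ∀ i, ∫ x in boundaryTarget (P.chart i), boundaryIntegrand P β i x
      = ∫ x in boundaryTarget e, (β.smul hD (P.ρ i)).coeff e (x : ℂ) := by
    intro i
    refine integral_boundaryTarget_eq (P.chart_mem i) he (fun x hx => ?_) (fun x hx hx' => ?_)
      (fun x hx hx' => ?_)
    · rw [ofReal_transition_re (P.chart_mem i) he hx]
      change (β.smul hD (P.ρ i)).coeff (P.chart i) x = _
      rw [(β.smul hD (P.ρ i)).compatible _ (P.chart_mem i) _ he x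
        (mem_puncturedTarget_of_real hD (P.chart_mem i) hx.1) hx.2]
      simp
    · rw [boundaryIntegrand, hS _ (P.chart_mem i) x
        (mem_puncturedTarget_of_real hD (P.chart_mem i) hx) fun h => hx' (hSe h), mul_zero]
    · exact β.supportedIn_smul hD (P.ρ i) e he x (mem_puncturedTarget_of_real hD he hx)
        fun h => hx' (P.subordinate i h)
  rw [boundarySum, Finset.sum_congr rfl fun i _ => h1 i, ← integral_finsetSum _ fun i _ =>
    (hS.smul hD (P.ρ i)).integrableOn_boundary hD he hSc hSe]
  refine integral_congr_ae (ae_of_all _ fun x => ?_)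
  simp only [PoleForm.smul]
  rw [← Finset.sum_mul, P.sum_eq_one, one_mul]

/-- Cut β into the pieces given by `Q`. Each piece lives in one chart, where the sum over `P`
reduces to its integral in that chart. -/
theorem boundarySum_independent (hD : Disjoint (D : Set X) (complexModel.boundary X))
    (β : PoleForm X D 0 1) : boundarySum P β = boundarySum Q β := by
  rw [boundarySum_eq_sum P hD (κ := fun j => β.smul hD (Q.ρ j)) fun e _ z _ => ?_]
  · refine Finset.sum_congr rfl fun j _ => ?_
    exact boundarySum_of_supportedIn P hD
      (β.supportedIn_smul hD (Q.ρ j)) (isClosed_tsupport _) (Q.chart_mem j) (Q.subordinate j)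
  · simp only [PoleForm.smul]
    rw [← Finset.sum_mul, Q.sum_eq_one, one_mul]

theorem hasBoundaryIntegral (hD : Disjoint (D : Set X) (complexModel.boundary X))
    (β : PoleForm X D 0 1) :
    HasBoundaryIntegral β (boundarySum P β) :=
  fun Q => ⟨integrableOn_boundaryIntegrand Q hD β, boundarySum_independent Q P hD β⟩

variable [T2Space X]

/-- Stokes' theorem for a `(0,1)`-form without poles supported in one coordinate domain. -/
theorem PoleForm.SupportedIn.integral_wirtinger {γ : PoleForm X D 0 1} {S : Set X}
    (hγ : γ.SupportedIn S) (hp : γ.PolesLE 0)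
    (hD : Disjoint (D : Set X) (complexModel.boundary X)) (he : e ∈ atlas HalfPlane X)
    (hS : IsClosed S) (hSe : S ⊆ e.source) :
    ∫ z in (coord e).target, wirtinger (γ.coeff e) z * (-2 * Complex.I)
      = ∫ x in boundaryTarget e, γ.coeff e (x : ℂ) := by
  classical
  set K := coord e '' S
  have hK : IsCompact K := isCompact_coord_image hS hSe
  have hKe : K ⊆ (coord e).target := coord_image_subset hSe
  choose! h hh heq using hp e he
  -- The coefficient is corrected over `D` by its smooth local extensions and set to zero off `K`.
  -- This gives a smooth function on the whole half plane that agrees with the coefficient on the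
  -- punctured domain.
  let f : ℂ → ℂ := fun z =>
    if z ∈ K then (if (coord e).symm z ∈ D then h ((coord e).symm z) z else γ.coeff e z) else 0
  have hf0 : ∀ z ∉ K, f z = 0 := fun z hz => if_neg hz
  have hfp : ∀ z ∈ puncturedTarget D e, f z = γ.coeff e z := by
    intro z hz
    by_cases hzK : z ∈ K
    · simp only [f]
      rw [if_pos hzK, if_neg hz.2]
    · rw [hf0 z hzK, hγ e he z hz (coord_symm_notMem ⟨hz.1, hzK⟩)]
  have hfpe : ∀ z ∈ puncturedTarget D e, f =ᶠ[𝓝[upperHalf] z] γ.coeff e := fun z hz => by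
    filter_upwards [puncturedTarget_mem_nhdsWithin hz] with w hw using hfp w hw
  have hf0e : ∀ z ∉ K, f =ᶠ[𝓝 z] fun _ => 0 := fun z hz => by
    filter_upwards [hK.isClosed.isOpen_compl.mem_nhds hz] with w hw using hf0 w hw
  have hfs : ContDiffOn ℝ ∞ f upperHalf := by
    intro z hzH
    by_cases hzK : z ∈ K
    swap
    · exact (contDiffAt_const.congr_of_eventuallyEq (hf0e z hzK)).contDiffWithinAt
    by_cases hzD : (coord e).symm z ∈ D
    · have hsrc := coord_symm_mem (hKe hzK)
      have hz := (coord e).right_inv (hKe hzK)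
      have h0 := coord_im_pos hD he hzD hsrc
      have hpe := punctured_eventually (D := D) hsrc h0
      have h1 := hh _ hzD hsrc
      have h2 := heq _ hzD hsrc
      rw [hz] at hpe h1 h2
      refine (h1.congr_of_eventuallyEq ?_).contDiffWithinAt
      have h3 : ∀ᶠ w in 𝓝[≠] z, f w = h ((coord e).symm z) w := by
        filter_upwards [hpe, h2] with w hw hw'
        rw [hfp w hw, hw', pow_zero, div_one]
      rw [eventually_nhdsWithin_iff] at h3
      filter_upwards [h3] with w hw
      by_cases hwz : w = z
      · subst hwz
        simp only [f]
        rw [if_pos hzK, if_pos hzD]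
      · exact hw hwz
    · have hz : z ∈ puncturedTarget D e := ⟨hKe hzK, hzD⟩
      exact ((γ.smooth e he z hz).mono_of_mem_nhdsWithin
        (puncturedTarget_mem_nhdsWithin hz)).congr_of_eventuallyEq (hfpe z hz) (hfp z hz)
  have key := integral_wirtinger_halfPlane hfs hK hf0
  rw [setIntegral_eq_of_subset_of_forall_sdiff_eq_zero isClosed_halfPlane.measurableSet
    (coord_target_subset e) (fun z hz => by
      rw [wirtinger_congr_nhds (hf0e z fun h => hz.2 (hKe h)), wirtinger_const _ hz.1,
        zero_mul])] at key
  rw [← setIntegral_eq_integral_of_forall_compl_eq_zero (s := boundaryTarget e)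
    (fun x hx => hf0 x fun h => hx (hKe h))] at key
  rw [setIntegral_congr_fun (measurableSet_boundaryTarget e) fun x hx =>
    hfp x (mem_puncturedTarget_of_real hD he hx)] at key
  rw [← key]
  refine setIntegral_congr_ae (measurableSet_target e) ?_
  filter_upwards [ae_mem_puncturedTarget D e] with z hz hzt
  rw [wirtinger_congr (hfpe z (hz hzt)) (coord_target_subset e hzt)]

/-- The integral of a `2`-form over the surface, computed with the partition `P`. -/
def surfaceSum (P : ChartPartition X) (α : PoleForm X D 1 1) : ℂ :=
  ∑ i, ∫ z in (coord (P.chart i)).target, surfaceIntegrand P α i z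

theorem integrableOn_surfaceIntegrand (hD : Disjoint (D : Set X) (complexModel.boundary X))
    {α : PoleForm X D 1 1} (hα : IsLogarithmic α) (i : Fin P.n) :
    IntegrableOn (surfaceIntegrand P α i) (coord (P.chart i)).target :=
  ((α.supportedIn_smul hD (P.ρ i)).integrableOn (PoleForm.PolesLE.smul hα hD (P.ρ i))
    (P.chart_mem i) (isClosed_tsupport _) (P.subordinate i)).mul_const _

theorem surfaceSum_eq_sum (hD : Disjoint (D : Set X) (complexModel.boundary X))
    {ι : Type*} [Fintype ι] {α : PoleForm X D 1 1}
    {κ : ι → PoleForm X D 1 1} (hκ : ∀ j, IsLogarithmic (κ j))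
    (h : ∀ e ∈ atlas HalfPlane X, ∀ z ∈ puncturedTarget D e,
      α.coeff e z = ∑ j, (κ j).coeff e z) :
    surfaceSum P α = ∑ j, surfaceSum P (κ j) := by
  simp only [surfaceSum]
  rw [Finset.sum_comm]
  refine Finset.sum_congr rfl fun i _ => ?_
  rw [← integral_finsetSum _ fun j _ => integrableOn_surfaceIntegrand P hD (hκ j) i]
  refine setIntegral_congr_ae (measurableSet_target _) ?_
  filter_upwards [ae_mem_puncturedTarget D (P.chart i)] with z hz hzt
  simp only [surfaceIntegrand]
  rw [h _ (P.chart_mem i) z (hz hzt), Finset.mul_sum, Finset.sum_mul]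

/-- As on the boundary, every ρ_i α is moved to the chart `e`. Being logarithmic provides the
integrability needed to exchange sum and integral. -/
theorem surfaceSum_of_supportedIn (hD : Disjoint (D : Set X) (complexModel.boundary X))
    {α : PoleForm X D 1 1} (hα : IsLogarithmic α) {S : Set X}
    (hS : α.SupportedIn S) (hSc : IsClosed S) (he : e ∈ atlas HalfPlane X) (hSe : S ⊆ e.source) :
    surfaceSum P α = ∫ z in (coord e).target, α.coeff e z * (-2 * Complex.I) := by
  have h1 : ∀ i, ∫ z in (coord (P.chart i)).target, surfaceIntegrand P α i z
      = ∫ z in (coord e).target, (α.smul hD (P.ρ i)).coeff e z * (-2 * Complex.I) := by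
    intro i
    refine integral_target_eq D (P.chart_mem i) he (fun z hz hz' => ?_) (fun z hz hz' => ?_)
      (fun z hz hz' => ?_)
    · change (α.smul hD (P.ρ i)).coeff (P.chart i) z * _ = _
      rw [(α.smul hD (P.ρ i)).compatible _ (P.chart_mem i) _ he z hz hz']
      ring
    · rw [surfaceIntegrand, hS _ (P.chart_mem i) z hz fun h => hz' (hSe h)]
      ring
    · rw [α.supportedIn_smul hD (P.ρ i) e he z hz fun h => hz' (P.subordinate i h), zero_mul]
  rw [surfaceSum, Finset.sum_congr rfl fun i _ => h1 i, ← integral_finsetSum _ fun i _ =>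
    ((hS.smul hD (P.ρ i)).integrableOn (PoleForm.PolesLE.smul hα hD (P.ρ i)) he hSc
      hSe).mul_const _]
  refine integral_congr_ae (ae_of_all _ fun z => ?_)
  simp only [PoleForm.smul]
  rw [← Finset.sum_mul, ← Finset.sum_mul, P.sum_eq_one, one_mul]

theorem surfaceSum_independent (hD : Disjoint (D : Set X) (complexModel.boundary X))
    {α : PoleForm X D 1 1} (hα : IsLogarithmic α) :
    surfaceSum P α = surfaceSum Q α := by
  rw [surfaceSum_eq_sum P hD (κ := fun j => α.smul hD (Q.ρ j))
    (fun j => PoleForm.PolesLE.smul hα hD (Q.ρ j)) fun e _ z _ => ?_]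
  · refine Finset.sum_congr rfl fun j _ => ?_
    exact surfaceSum_of_supportedIn P hD (PoleForm.PolesLE.smul hα hD (Q.ρ j))
      (α.supportedIn_smul hD (Q.ρ j)) (isClosed_tsupport _) (Q.chart_mem j) (Q.subordinate j)
  · simp only [PoleForm.smul]
    rw [← Finset.sum_mul, Q.sum_eq_one, one_mul]

/-- Stokes' theorem for `(0,1)`-forms without poles. -/
theorem surfaceSum_del (hD : Disjoint (D : Set X) (complexModel.boundary X))
    {γ : PoleForm X D 0 1} (hγ : γ.PolesLE 0) :
    surfaceSum P (γ.del hD) = boundarySum P γ := by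
  -- The partition is inserted under ∂: the forms ∂(ρ_j γ) sum to ∂γ, so derivatives of the ρ_j
  -- never have to be computed, and each ρ_j γ is supported in one chart.
  rw [surfaceSum_eq_sum P hD (κ := fun j => (γ.smul hD (P.ρ j)).del hD)
    (fun j => (hγ.smul hD (P.ρ j)).del hD) fun e he z hz => ?_]
  · refine Finset.sum_congr rfl fun j _ => ?_
    rw [surfaceSum_of_supportedIn P hD ((hγ.smul hD (P.ρ j)).del hD)
      ((γ.supportedIn_smul hD (P.ρ j)).del (isClosed_tsupport _) hD) (isClosed_tsupport _)
      (P.chart_mem j) (P.subordinate j)]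
    exact (γ.supportedIn_smul hD (P.ρ j)).integral_wirtinger (hγ.smul hD (P.ρ j)) hD
      (P.chart_mem j) (isClosed_tsupport _) (P.subordinate j)
  · have hzH := puncturedTarget_subset_upperHalf hz
    change wirtinger (γ.coeff e) z = ∑ j, wirtinger ((γ.smul hD (P.ρ j)).coeff e) z
    rw [← wirtinger_sum _ (fun j _ => (γ.smul hD (P.ρ j)).differentiableWithinAt he hz) hzH]
    congr 1
    funext w
    simp only [PoleForm.smul]
    rw [← Finset.sum_mul, P.sum_eq_one, one_mul]

/-- The form γ = β' - β satisfies ∂γ = α - α', which is logarithmic. Hence γ has no poles, and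
Stokes' theorem equates the change of the surface term with that of the boundary term. -/
theorem surfaceSum_add_boundarySum_eq (hD : Disjoint (D : Set X) (complexModel.boundary X))
    {θ α α' : PoleForm X D 1 1} {β β' : PoleForm X D 0 1}
    (hα : IsLogarithmic α) (hα' : IsLogarithmic α') (h : IsSplitting θ α β)
    (h' : IsSplitting θ α' β') :
    surfaceSum P α + boundarySum P β = surfaceSum P α' + boundarySum P β' := by
  set γ := β'.sub β
  have hγ : ∀ e ∈ atlas HalfPlane X, ∀ z ∈ puncturedTarget D e,
      (γ.del hD).coeff e z = α.coeff e z - α'.coeff e z := by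
    intro e he z hz
    have h1 := h e he z hz
    have h2 := h' e he z hz
    change wirtinger (fun w => β'.coeff e w - β.coeff e w) z = _
    rw [wirtinger_sub (β'.differentiableWithinAt he hz) (β.differentiableWithinAt he hz)
      (puncturedTarget_subset_upperHalf hz)]
    linear_combination h1 - h2
  have hlog : IsLogarithmic (γ.del hD) := by
    intro e he x hxD hx
    refine ((hα e he x hxD hx).sub (hα' e he x hxD hx)).congr ?_
    filter_upwards [punctured_eventually (D := D) hx (coord_im_pos hD he hxD hx)] with z hz
    exact hγ e he z hz
  have h1 : surfaceSum P α = ∑ j, surfaceSum P (![α', γ.del hD] j) := by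
    refine surfaceSum_eq_sum P hD (fun j => ?_) fun e he z hz => ?_
    · fin_cases j
      · exact hα'
      · exact hlog
    · rw [Fin.sum_univ_two]
      change _ = α'.coeff e z + (γ.del hD).coeff e z
      rw [hγ e he z hz]
      ring
  have h2 : boundarySum P β' = ∑ j, boundarySum P (![β, γ] j) := by
    refine boundarySum_eq_sum P hD fun e _ z _ => ?_
    rw [Fin.sum_univ_two]
    change _ = β.coeff e z + (β'.coeff e z - β.coeff e z)
    ring
  rw [Fin.sum_univ_two] at h1 h2
  have h3 := surfaceSum_del P hD (polesLE_zero_of_del hD hlog)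
  change surfaceSum P α = surfaceSum P α' + surfaceSum P (γ.del hD) at h1
  change boundarySum P β' = boundarySum P β + boundarySum P γ at h2
  linear_combination h1 + h3 - h2

theorem hasSurfaceIntegral (hD : Disjoint (D : Set X) (complexModel.boundary X))
    {α : PoleForm X D 1 1} (hα : IsLogarithmic α) :
    HasSurfaceIntegral α (surfaceSum P α) :=
  fun Q => ⟨integrableOn_surfaceIntegrand Q hD hα, surfaceSum_independent Q P hD hα⟩

end Regularization

end RegInt

end

theorem theorem2p3 {X : Type*} [TopologicalSpace X] [T2Space X] [CompactSpace X]
    [ChartedSpace RegInt.HalfPlane X] [IsManifold RegInt.complexModel ∞ X]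
    (D : Finset X) (hD : Disjoint (D : Set X) (RegInt.complexModel.boundary X))
    (θ : RegInt.PoleForm X D 1 1) :
    (∃ (α : RegInt.PoleForm X D 1 1) (β : RegInt.PoleForm X D 0 1),
      RegInt.IsLogarithmic α ∧ RegInt.IsSplitting θ α β) ∧
    (∃! c : ℂ, ∀ (α : RegInt.PoleForm X D 1 1) (β : RegInt.PoleForm X D 0 1),
      RegInt.IsLogarithmic α → RegInt.IsSplitting θ α β →
        ∃ a b : ℂ, RegInt.HasSurfaceIntegral α a ∧ RegInt.HasBoundaryIntegral β b ∧
          a + b = c) := by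
  refine ⟨RegInt.exists_splitting hD θ, ?_⟩
  obtain ⟨α₀, β₀, hα₀, hs₀⟩ := RegInt.exists_splitting hD θ
  obtain ⟨P⟩ := RegInt.nonempty_chartPartition (X := X)
  refine ⟨RegInt.surfaceSum P α₀ + RegInt.boundarySum P β₀, fun α β hα hs =>
    ⟨_, _, RegInt.hasSurfaceIntegral P hD hα, RegInt.hasBoundaryIntegral P hD β,
      RegInt.surfaceSum_add_boundarySum_eq P hD hα hα₀ hs hs₀⟩, fun c hc => ?_⟩
  -- One existing splitting, evaluated with the one partition `P`, already determines c.
  obtain ⟨a, b, ha, hb, rfl⟩ := hc α₀ β₀ hα₀ hs₀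
  rw [← (ha P).2, ← (hb P).2]
  rfl
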